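/- **Finite programs.** For $d\in\{1,\dots,5\}$ and $K=150$ consider the program in the variables $\rho\in\mathbb R$ and $g(0),\dots,g(K)\ge 0$: $$\min \rho\quad\text{s.t.}\quad \rho\sum_{i=z+1}^{z+m} i^d - m\,g(n+z+1)+n\,g(n+z)\ \ge\ \sum_{i=z+1}^{z+n} i^d\qquad(n,z,m\in\mathbb N,\ n+z<K,\ m\le (K+1)^2(d+1)),\qquad g(K)\ge \rho^{1/(d+1)}K^d .$$ Let $\rho_d$ be its infimum. For an optimal solution $g$ let $\hat g(n)=g(n)$ for $n<K$ and $\hat g(n)=\rho_d^{1/(d+1)}n^d$ for $n\ge K$. **Games.** A congestion game has $N$ players, a finite set $E$ of resources, for each player $u$ a non-empty set $S_u$ of strategies (subsets of $E$), and resource costs $f_e$. In a state $s=(s_u)_u$ with $s_u\in S_u$, let $n_e(s)=|\{u: e\in s_u\}|$; player $u$ pays $c_u(s)=\sum_{e\in s_u}f_e(n_e(s))$. A state is an $\alpha$-approximate pure Nash equilibrium if $c_u(s)\le\alpha\,c_u(t,s_{-u})$ for all $u$ and all $t\in S_u$. Let $f_e(x)=\sum_{j=0}^d a_{e,j}x^j$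 with $a_{e,j}\ge0$. The modified costs are $f'_e(x)=a_{e,0}+\sum_{j=1}^d a_{e,j}\hat g_j(x)$, where $g_j$ is an optimal solution of the program for degree $j$; $c'_u$ denotes the players' costs under $f'$. **Algorithm, with parameters $p>1$ and $c\in\mathbb N$.** Put $q=1+N^{-c}$, $\Delta=\max_e f_e(N)/f_e(1)$ (resources of cost $0$ are ignored), $r=2\Delta N^{2c+2}$, $\ell_u=\min_{t\in S_u}\sum_{e\in t}f_e(1)$ and $\ell_{\max}=\max_u\ell_u$. Block $B_i$, $i\ge1$, consists of the players with $\ell_u\in(\ell_{\max}r^{-i},\ell_{\max}r^{-i+1}]$. Start with every player on a strategy that attains $\ell_u$. For each $i$ with $B_i\ne\emptyset$, in increasing order, run phase $i$: as long as there is a player $u\in B_i$ with some $t\in S_u$ such that $c_u(t,s_{-u})<c_u(s)/p$, or a player $u\in B_{i+1}$ with some $t\in S_u$ such that $c'_u(t,s_{-u})<c'_u(s)/q$, let one such player deviate to a best response (with respect to $c_u$ in the first case and $c'_u$ in the second). Ties and the order of moves are arbitrary. A step is a deviation of a player or a transition to the next phase. **Theorem.** (i) For $d=1,\dots,5$ the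 minimum $\rho_d$ is attained, and up to an error of at most $0.005$ the values are $\rho_1\approx1.61$, $\rho_2\approx3.35$, $\rho_3\approx8.58$, $\rho_4\approx27.46$, $\rho_5\approx98.14$. (ii) For $d=1,\dots,5$ and every optimal solution $g$ of the program for degree $d$, the inequality $\rho_d\sum_{i=z+1}^{z+m} i^d - m\,\hat g(n+z+1)+n\,\hat g(n+z)\ge\sum_{i=z+1}^{z+n} i^d$ holds for all $n,z,m\in\mathbb N$. (iii) Let $1\le d\le5$, $\varepsilon>0$ and $\rho_d<p<\rho_d+\varepsilon$. There is a $c_0$ such that for every integer $c\ge c_0$ there is a polynomial $Q$, where $c_0$ depends only on $d,\varepsilon,p$ and $Q$ only on $d,\varepsilon,p,c$, with the following property. For every congestion game with $N$ players whose costs are polynomials of degree at most $d$ with non-negative coefficients, every choice of the optimal solutions $g_1,\dots,g_d$, and every execution, the algorithm stops after at most $Q(N)$ steps, in a $(\rho_d+\varepsilon)$-approximate pure Nash equilibrium. -/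

import Mathlib

/-- A congestion game with players `ι` and resources `E`: nonempty finite strategy sets of subsets
of `E`, and non-negative non-decreasing resource costs (a function of the number of users). -/
structure CongestionGame (ι E : Type) where
  strategies : ι → Finset (Finset E)
  strategies_nonempty : ∀ u, (strategies u).Nonempty
  cost : E → ℕ → ℝ
  cost_nonneg : ∀ e n, 0 ≤ cost e n
  cost_mono : ∀ e, Monotone (cost e)

/-- Number of players that use the resource `e` in the state `s`. -/
def load {ι E : Type} [Fintype ι] [DecidableEq E] (s : ι → Finset E) (e : E) : ℕ :=
  (Finset.univ.filter fun u => e ∈ s u).card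

/-- Cost of player `u` in the state `s` when the resources have cost functions `f`. -/
def playerCost {ι E : Type} [Fintype ι] [DecidableEq E]
    (f : E → ℕ → ℝ) (s : ι → Finset E) (u : ι) : ℝ :=
  ∑ e ∈ s u, f e (load s e)

namespace CongestionGame

variable {ι E : Type} [Fintype ι] [DecidableEq ι] [Fintype E] [DecidableEq E]

/-- `s` is an `α`-approximate pure Nash equilibrium of `G`. -/
def IsApproxNash (G : CongestionGame ι E) (α : ℝ) (s : ι → Finset E) : Prop :=
  ∀ u, s u ∈ G.strategies u ∧ ∀ t ∈ G.strategies u,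
    playerCost G.cost s u ≤ α * playerCost G.cost (Function.update s u t) u

/-- With respect to the costs `f`, player `u` has in `s` a deviation that improves its cost by more
than the factor `α`. -/
def HasMove (G : CongestionGame ι E) (f : E → ℕ → ℝ) (α : ℝ) (s : ι → Finset E) (u : ι) : Prop :=
  ∃ t ∈ G.strategies u, playerCost f (Function.update s u t) u < playerCost f s u / α

/-- With respect to the costs `f`, the strategy `t` is a best response of `u` to the strategies of
the other players in `s`. -/
def IsBestResponse (G : CongestionGame ι E) (f : E → ℕ → ℝ) (s : ι → Finset E) (u : ι)
    (t : Finset E) : Prop :=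
  t ∈ G.strategies u ∧ ∀ t' ∈ G.strategies u,
    playerCost f (Function.update s u t) u ≤ playerCost f (Function.update s u t') u

/-- Cost that a strategy has for a player who is alone in the game. -/
def aloneCost (G : CongestionGame ι E) (t : Finset E) : ℝ := ∑ e ∈ t, G.cost e 1

/-- `ℓ_u`: the smallest cost that player `u` could have if it were alone in the game. -/
noncomputable def ell (G : CongestionGame ι E) (u : ι) : ℝ :=
  (G.strategies u).inf' (G.strategies_nonempty u) G.aloneCost

/-- `ℓ_max`. -/
noncomputable def ellMax (G : CongestionGame ι E) : ℝ := ⨆ u, G.ell u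

/-- `Δ = max_e f_e(N) / f_e(1)`, where `N` is the number of players. A resource with `f_e(1) = 0`
counts as `0` here (for polynomials with non-negative coefficients it has `f_e = 0`). -/
noncomputable def Delta (G : CongestionGame ι E) : ℝ :=
  ⨆ e, G.cost e (Fintype.card ι) / G.cost e 1

/-- Ratio `2 Δ N ^ (2 c + 2)` of consecutive block boundaries. -/
noncomputable def blockRatio (G : CongestionGame ι E) (c : ℕ) : ℝ :=
  2 * G.Delta * (Fintype.card ι : ℝ) ^ (2 * c + 2)

/-- Player `u` lies in the block with number `i`. Blocks are numbered from `0`. Players with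
`ℓ_u = 0` lie in no block. -/
def InBlock (G : CongestionGame ι E) (c i : ℕ) (u : ι) : Prop :=
  G.ellMax / G.blockRatio c ^ (i + 1) < G.ell u ∧ G.ell u ≤ G.ellMax / G.blockRatio c ^ i

/-- Improvement factor `q = 1 + 1 / N ^ c`. -/
noncomputable def qFactor (ι : Type) [Fintype ι] (c : ℕ) : ℝ :=
  1 + 1 / (Fintype.card ι : ℝ) ^ c

/-- In phase `i` and state `s`, player `u` is allowed to move: it lies in block `i` and has a
`p`-move for the original costs, or it lies in block `i + 1` and has a `q`-move for the modified
costs `f'`. In both cases `t` is a best response of `u` for the respective costs. -/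
def AllowedMove (G : CongestionGame ι E) (f' : E → ℕ → ℝ) (p : ℝ) (c i : ℕ) (s : ι → Finset E)
    (u : ι) (t : Finset E) : Prop :=
  (G.InBlock c i u ∧ G.HasMove G.cost p s u ∧ G.IsBestResponse G.cost s u t) ∨
  (G.InBlock c (i + 1) u ∧ G.HasMove f' (qFactor ι c) s u ∧ G.IsBestResponse f' s u t)

/-- One step of the algorithm on pairs (number of the current phase, current state): either an
allowed player deviates to a best response, or, if no player is allowed to move, the algorithm goes
on to the next phase whose block is nonempty. -/
def Step (G : CongestionGame ι E) (f' : E → ℕ → ℝ) (p : ℝ) (c : ℕ)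
    (x y : ℕ × (ι → Finset E)) : Prop :=
  (y.1 = x.1 ∧ ∃ u t, G.AllowedMove f' p c x.1 x.2 u t ∧ y.2 = Function.update x.2 u t) ∨
  (y.2 = x.2 ∧ (∀ u t, ¬ G.AllowedMove f' p c x.1 x.2 u t) ∧ x.1 < y.1 ∧
    (∃ u, G.InBlock c y.1 u) ∧ ∀ k, x.1 < k → k < y.1 → ∀ u, ¬ G.InBlock c k u)

/-- Initial configuration: the first phase, and every player on a strategy that is optimal for it
when it is alone in the game (ties are broken arbitrarily). -/
def IsInitial (G : CongestionGame ι E) (x : ℕ × (ι → Finset E)) : Prop :=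
  x.1 = 0 ∧ ∀ u, x.2 u ∈ G.strategies u ∧ G.aloneCost (x.2 u) = G.ell u

/-- The first `k` steps of some execution of the algorithm. -/
def IsRun (G : CongestionGame ι E) (f' : E → ℕ → ℝ) (p : ℝ) (c k : ℕ)
    (x : ℕ → ℕ × (ι → Finset E)) : Prop :=
  G.IsInitial (x 0) ∧ ∀ t < k, G.Step f' p c (x t) (x (t + 1))

/-- The algorithm has stopped: no step is possible. -/
def Halted (G : CongestionGame ι E) (f' : E → ℕ → ℝ) (p : ℝ) (c : ℕ)
    (x : ℕ × (ι → Finset E)) : Prop :=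
  ∀ y, ¬ G.Step f' p c x y

end CongestionGame

/-- Sum of `i ^ d` over `z < i ≤ z + m`. -/
def powerSum (d z m : ℕ) : ℝ := ∑ i ∈ Finset.Icc (z + 1) (z + m), (i : ℝ) ^ d

/-- Strong `(r, 0)`-smoothness inequality of `g` for the cost function `x ^ d`, with `z` players
frozen on the resource, and `n` respectively `m` of the other players on it in the two states. -/
def SmoothAt (d : ℕ) (r : ℝ) (g : ℕ → ℝ) (z n m : ℕ) : Prop :=
  powerSum d z n ≤ r * powerSum d z m - m * g (n + z + 1) + n * g (n + z)

/-- `(r, g)` is feasible for the finite program with the first `K` values of `x ^ d`. -/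
def LPFeasible (K d : ℕ) (r : ℝ) (g : ℕ → ℝ) : Prop :=
  (∀ n z m : ℕ, n + z < K → m ≤ (K + 1) ^ 2 * (d + 1) → SmoothAt d r g z n m) ∧
  r ^ (1 / ((d : ℝ) + 1)) * (K : ℝ) ^ d ≤ g K ∧
  ∀ n ≤ K, 0 ≤ g n

/-- Objective values of the finite program with `K = 150`. -/
def LPValues (d : ℕ) : Set ℝ := {r | ∃ g : ℕ → ℝ, LPFeasible 150 d r g}

/-- `ρ_d`, the optimal value of the finite program with `K = 150`. -/
noncomputable def rho (d : ℕ) : ℝ := sInf (LPValues d)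

/-- Modified cost function on all loads: `g` below `150`, and `ν n ^ d` with
`ν = ρ_d ^ (1 / (d + 1))` from `150` on. -/
noncomputable def extendCost (d : ℕ) (g : ℕ → ℝ) (n : ℕ) : ℝ :=
  if n < 150 then g n else rho d ^ (1 / ((d : ℝ) + 1)) * (n : ℝ) ^ d

/-- Modified cost of a resource whose cost is the polynomial `P` of degree at most `d`: the constant
term is kept, and `x ^ j` is replaced by the extension of `g j`. -/
noncomputable def modifiedCost (d : ℕ) (g : ℕ → ℕ → ℝ) (P : Polynomial ℝ) (n : ℕ) : ℝ :=
  P.coeff 0 + ∑ j ∈ Finset.Icc 1 d, P.coeff j * extendCost j (g j) n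

/-! Optimal values. The constraints without frozen players bound `g 1`, `g 2`, … from above one
after the other; since `n ^ d ≤ g n`, a short chain of them bounds `r` from below. For the upper
bounds an explicit table is continued by `ν x ^ d` with `ν = r ^ (1 / (d + 1))`. This power is
smooth at large loads (`smooth_scaled_pow`): sums are compared with integrals, and the tangent to `x
^ (d + 1)` at `N + 1` reduces the claim, up to the factor `(1 + 1 / N) ^ (d + 1)`, to `d + 2 - 1 / r
≤ (d + 1) ν`. That is the AM-GM inequality for `1 / r` and `d + 1` copies of `ν`, strict for `ν >
1`. The same lemma extends optimal solutions beyond load 150. The minimum is attained by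
compactness.

Algorithm. Summed over the resources, strong smoothness says: if a set of players is almost in
equilibrium for the modified costs `f'`, its share of Rosenthal's potential is at most about `ρ`
times its share after any change of its strategies (`potential_le_of_stronglySmooth`). A block
enters its own phase in this situation if the preceding phase let it make its `q`-moves. On the
other hand, for `ρ < p' < p`, the `p`-moves push the potential of the movers down by nearly the
factor `p'` (`mul_potential_movers_le`). Since `p' > ρ`, both can hold only if the movers of the
block have total cost of the order of the much smaller costs of the next block (`movers_cost_le`).
Hence whatever moves after phase `j` hardly changes the costs of the players of block `j`, who left
that phase without `p`-moves (`GoodRun.isApproxNash`).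

The factor `p'` needs care, because cheap moves of the next block can raise the potential. Expensive
`p`-moves pay for the cheap moves that precede them, and moves of intermediate cost, in a window
`(h, H]`, are an error term. The potential of `f'` never increases during a phase, which bounds the
total cost of all `p`-moves (`sum_windowCost_le`); among sufficiently many disjoint windows one
therefore has a negligible share.

Running time. Every move lowers the potential of `f'` by a definite fraction of the mover's cost,
while the potential available to the two active blocks is only polynomially larger than their
smallest cost (`moves_mul_le`). There are at most as many phases as players. -/

set_option linter.unusedSectionVars false

/-! ### Power sums and smoothness of scaled powers -/

/-- Sum of `f i` over `z < i ≤ z + n`. -/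
def intervalSum (f : ℕ → ℝ) (z n : ℕ) : ℝ := ∑ i ∈ Finset.Icc (z + 1) (z + n), f i

@[simp] theorem intervalSum_zero (f : ℕ → ℝ) (z : ℕ) : intervalSum f z 0 = 0 := by
  simp [intervalSum]

theorem intervalSum_succ (f : ℕ → ℝ) (z n : ℕ) :
    intervalSum f z (n + 1) = intervalSum f z n + f (z + n + 1) := by
  unfold intervalSum
  rw [← add_assoc, Finset.sum_Icc_succ_top (by omega)]

theorem intervalSum_add (f : ℕ → ℝ) (z m n : ℕ) :
    intervalSum f z (m + n) = intervalSum f z m + intervalSum f (z + m) n := by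
  induction n with
  | zero => simp
  | succ n ih => rw [← add_assoc, intervalSum_succ, ih, intervalSum_succ]; simp only [add_assoc]

theorem powerSum_eq (d z m : ℕ) : powerSum d z m = intervalSum (fun i => (i : ℝ) ^ d) z m := rfl

@[simp] theorem powerSum_zero (d z : ℕ) : powerSum d z 0 = 0 := by simp [powerSum]

theorem powerSum_succ (d z m : ℕ) :
    powerSum d z (m + 1) = powerSum d z m + ((z : ℝ) + m + 1) ^ d := by
  rw [powerSum_eq, intervalSum_succ, ← powerSum_eq]; push_cast; rfl

theorem powerSum_nonneg (d z m : ℕ) : 0 ≤ powerSum d z m :=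
  Finset.sum_nonneg fun _ _ => by positivity

theorem SmoothAt.mono {d : ℕ} {r r' : ℝ} {g : ℕ → ℝ} {z n m : ℕ} (h : SmoothAt d r g z n m)
    (hr : r ≤ r') : SmoothAt d r' g z n m := by
  unfold SmoothAt at *
  have := mul_le_mul_of_nonneg_right hr (powerSum_nonneg d z m)
  linarith

/-- Beyond the point where `r (z + m) ^ d` reaches `g (n + z + 1)`, the smoothness inequality only
becomes weaker as `m` grows. -/
theorem SmoothAt.of_le {d : ℕ} {r : ℝ} {g : ℕ → ℝ} {z n m m' : ℕ} (hr : 0 ≤ r)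
    (h : SmoothAt d r g z n m) (hg : g (n + z + 1) ≤ r * ((z : ℝ) + m + 1) ^ d) (hm : m ≤ m') :
    SmoothAt d r g z n m' := by
  induction m', hm using Nat.le_induction with
  | base => exact h
  | succ k hk ih =>
    unfold SmoothAt at *
    rw [powerSum_succ]
    have h1 : ((z : ℝ) + m + 1) ^ d ≤ ((z : ℝ) + k + 1) ^ d := by
      have : (m : ℝ) ≤ k := by exact_mod_cast hk
      gcongr
    have h2 := mul_le_mul_of_nonneg_left h1 hr
    push_cast
    nlinarith

/-- Convexity: the graph of `x ^ (d + 1)` lies above its tangent at `a`. -/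
theorem pow_tangent_le (d : ℕ) {a b : ℝ} (ha : 0 ≤ a) (hb : 0 ≤ b) :
    a ^ (d + 1) + (d + 1) * a ^ d * (b - a) ≤ b ^ (d + 1) := by
  induction d with
  | zero => simp
  | succ d ih =>
    have h1 := mul_le_mul_of_nonneg_left ih hb
    have h2 : 0 ≤ ((d : ℝ) + 1) * a ^ d * (b - a) ^ 2 := by positivity
    push_cast
    calc a ^ (d + 1 + 1) + (d + 1 + 1) * a ^ (d + 1) * (b - a)
        = b * (a ^ (d + 1) + (d + 1) * a ^ d * (b - a)) - ((d : ℝ) + 1) * a ^ d * (b - a) ^ 2 := by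
          ring
      _ ≤ b * b ^ (d + 1) := by linarith
      _ = b ^ (d + 1 + 1) := by ring

/-- Comparison with the integral of `x ^ d`, in telescoped form: each new term is one tangent
inequality. The upper bound below shifts the interval of integration by one. -/
theorem powerSum_lower (d z m : ℕ) :
    ((z : ℝ) + m) ^ (d + 1) - (z : ℝ) ^ (d + 1) ≤ (d + 1) * powerSum d z m := by
  induction m with
  | zero => simp
  | succ m ih =>
    rw [powerSum_succ]
    have := pow_tangent_le d (a := (z : ℝ) + m + 1) (b := (z : ℝ) + m) (by positivity)
      (by positivity)
    push_cast
    rw [← add_assoc]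
    nlinarith

theorem powerSum_upper (d z m : ℕ) :
    (d + 1) * powerSum d z m ≤ ((z : ℝ) + m + 1) ^ (d + 1) - ((z : ℝ) + 1) ^ (d + 1) := by
  induction m with
  | zero => simp
  | succ m ih =>
    rw [powerSum_succ]
    have := pow_tangent_le d (a := (z : ℝ) + m + 1) (b := (z : ℝ) + m + 1 + 1) (by positivity)
      (by positivity)
    push_cast
    rw [← add_assoc]
    nlinarith

theorem powerSum_ge_mul (d z m : ℕ) : m * ((z : ℝ) + 1) ^ d ≤ powerSum d z m := by
  induction m with
  | zero => simp
  | succ m ih =>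
    rw [powerSum_succ]
    have : ((z : ℝ) + 1) ^ d ≤ ((z : ℝ) + m + 1) ^ d := by
      have : (0 : ℝ) ≤ m := by positivity
      gcongr; linarith
    push_cast
    nlinarith

theorem powerSum_le_mul (d z m : ℕ) : powerSum d z m ≤ m * ((z : ℝ) + m) ^ d := by
  induction m with
  | zero => simp
  | succ m ih =>
    rw [powerSum_succ]
    have h1 : ((z : ℝ) + m) ^ d ≤ ((z : ℝ) + m + 1) ^ d :=
      pow_le_pow_left₀ (by positivity) (by linarith) _
    have h2 : (m : ℝ) * ((z : ℝ) + m) ^ d ≤ m * ((z : ℝ) + m + 1) ^ d := by gcongr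
    push_cast
    rw [← add_assoc]
    nlinarith

/-- The scaled power `ν x ^ d` with `ν = r ^ (1 / (d + 1))` is smooth once the load is so large that
rounding effects are dominated by the gap `ν - 1`. -/
theorem smooth_scaled_pow {d : ℕ} {r ν : ℝ} (hν : 1 ≤ ν) (hr : r = ν ^ (d + 1)) {N z n m : ℕ}
    (hN : n + z = N)
    (hgap : ((N : ℝ) + 1) ^ (d + 1) * (d + 2 - 1 / r) ≤ (d + 1) * ν * (N : ℝ) ^ (d + 1)) :
    powerSum d z n ≤ r * powerSum d z m - m * (ν * ((N : ℝ) + 1) ^ d) + n * (ν * (N : ℝ) ^ d) := by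
  have hr1 : 1 ≤ r := hr ▸ one_le_pow₀ hν
  have hNR : (N : ℝ) = n + z := by rw [← hN]; push_cast; ring
  have hν0 : 0 < ν := by linarith
  rcases le_total (ν * ((z : ℝ) + 1)) ((N : ℝ) + 1) with hz | hz
  · have hd : (0 : ℝ) < d + 1 := by positivity
    refine le_of_mul_le_mul_left ?_ hd
    have h1 := mul_le_mul_of_nonneg_left (powerSum_lower d z m) (by linarith : 0 ≤ r)
    have h2 := powerSum_upper d z n
    -- The tangent at `N + 1`, evaluated at `ν (z + m)`, extracts the term linear in `m` from `r (z
    -- + m) ^ (d + 1)`.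
    have h3 := pow_tangent_le d (a := (N : ℝ) + 1) (b := ν * ((z : ℝ) + m)) (by positivity)
      (by positivity)
    rw [mul_pow, ← hr] at h3
    have h4 : r * ((z : ℝ) + 1) ^ (d + 1) ≤ ((N : ℝ) + 1) ^ (d + 1) := by
      rw [hr, ← mul_pow]; gcongr
    have h5 : r * (z : ℝ) ^ (d + 1) ≤ r * ((z : ℝ) + 1) ^ (d + 1) := by
      have : (z : ℝ) ≤ z + 1 := by linarith
      gcongr
    have h6 : (r - 1) * ((z : ℝ) + 1) ^ (d + 1) ≤ (1 - 1 / r) * ((N : ℝ) + 1) ^ (d + 1) := by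
      have e : (r - 1) * ((z : ℝ) + 1) ^ (d + 1) = (1 - 1 / r) * (r * ((z : ℝ) + 1) ^ (d + 1)) := by
        field_simp
      rw [e]
      have : 0 ≤ 1 - 1 / r := by
        rw [sub_nonneg, div_le_one (by linarith)]; exact hr1
      gcongr
    have h7 : (N : ℝ) ^ d ≤ ((N : ℝ) + 1) ^ d := by gcongr; linarith
    have h8 : (d + 1) * (z * ν) * (N : ℝ) ^ d ≤ (d + 1) * (z * ν) * ((N : ℝ) + 1) ^ d := by gcongr
    have h9 : ((z : ℝ) + n + 1) = N + 1 := by rw [hNR]; ring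
    rw [h9] at h2
    have e1 : (n : ℝ) = N - z := by rw [hNR]; ring
    have e2 : (N : ℝ) ^ (d + 1) = N ^ d * N := pow_succ _ _
    have e3 : ((N : ℝ) + 1) ^ (d + 1) = (N + 1) ^ d * (N + 1) := pow_succ _ _
    rw [e1]
    rw [e2] at hgap
    nlinarith
  -- With this many frozen players, each of the `m` terms of the sum alone pays for one copy of `ν
  -- (N + 1) ^ d`.
  · have h1 : ν * ((N : ℝ) + 1) ^ d ≤ r * ((z : ℝ) + 1) ^ d := by
      have : r * ((z : ℝ) + 1) ^ d = ν * (ν * ((z : ℝ) + 1)) ^ d := by rw [hr, mul_pow]; ring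
      rw [this]; gcongr
    have h2 := mul_le_mul_of_nonneg_left (powerSum_ge_mul d z m) (by linarith : 0 ≤ r)
    have h3 := powerSum_le_mul d z n
    have h4 : (m : ℝ) * (ν * ((N : ℝ) + 1) ^ d) ≤ m * (r * ((z : ℝ) + 1) ^ d) := by gcongr
    have h5 : (n : ℝ) * (1 * (N : ℝ) ^ d) ≤ n * (ν * (N : ℝ) ^ d) := by gcongr
    have e : (z : ℝ) + n = N := by rw [hNR]; ring
    rw [e] at h3
    linarith

/-- The gap condition of `smooth_scaled_pow` only has to be checked at the smallest load. -/
theorem gap_of_le {d N₀ N : ℕ} {r ν lo hi : ℝ} (hr0 : 0 < r) (hr : r ≤ hi) (hν : lo ≤ ν)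
    (hN₀ : 0 < N₀) (hN : N₀ ≤ N) (hhi : 1 ≤ hi)
    (h : ((N₀ : ℝ) + 1) ^ (d + 1) * (d + 2 - 1 / hi) ≤ (d + 1) * lo * (N₀ : ℝ) ^ (d + 1)) :
    ((N : ℝ) + 1) ^ (d + 1) * (d + 2 - 1 / r) ≤ (d + 1) * ν * (N : ℝ) ^ (d + 1) := by
  have h0 : (0 : ℝ) < N₀ := by exact_mod_cast hN₀
  have h1 : (N₀ : ℝ) ≤ N := by exact_mod_cast hN
  -- The factor `(1 + 1 / N) ^ (d + 1)` decreases in `N`.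
  have h2 : ((N₀ : ℝ) * (N + 1)) ^ (d + 1) ≤ (((N₀ : ℝ) + 1) * N) ^ (d + 1) := by
    apply pow_le_pow_left₀ (by positivity)
    nlinarith
  have h3 : 1 / hi ≤ 1 / r := by gcongr
  have h4 : 1 / hi ≤ 1 := by rw [div_le_one (by linarith)]; exact hhi
  have hd : (0 : ℝ) ≤ d := by positivity
  refine le_of_mul_le_mul_left ?_ (pow_pos h0 (d + 1))
  calc (N₀ : ℝ) ^ (d + 1) * (((N : ℝ) + 1) ^ (d + 1) * (d + 2 - 1 / r))
      ≤ (N₀ : ℝ) ^ (d + 1) * (((N : ℝ) + 1) ^ (d + 1) * (d + 2 - 1 / hi)) := by gcongr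
    _ = ((N₀ : ℝ) * (N + 1)) ^ (d + 1) * (d + 2 - 1 / hi) := by rw [mul_pow]; ring
    _ ≤ (((N₀ : ℝ) + 1) * N) ^ (d + 1) * (d + 2 - 1 / hi) := by
        apply mul_le_mul_of_nonneg_right h2; linarith
    _ = (N : ℝ) ^ (d + 1) * (((N₀ : ℝ) + 1) ^ (d + 1) * (d + 2 - 1 / hi)) := by rw [mul_pow]; ring
    _ ≤ (N : ℝ) ^ (d + 1) * ((d + 1) * lo * (N₀ : ℝ) ^ (d + 1)) := by gcongr
    _ ≤ (N : ℝ) ^ (d + 1) * ((d + 1) * ν * (N₀ : ℝ) ^ (d + 1)) := by gcongr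
    _ = (N₀ : ℝ) ^ (d + 1) * ((d + 1) * ν * (N : ℝ) ^ (d + 1)) := by ring

theorem rpow_root_pow {r : ℝ} (hr : 0 ≤ r) (d : ℕ) : (r ^ (1 / ((d : ℝ) + 1))) ^ (d + 1) = r := by
  rw [← Real.rpow_natCast, ← Real.rpow_mul hr]
  push_cast
  rw [one_div_mul_cancel (by positivity), Real.rpow_one]

theorem le_rpow_root {r a : ℝ} (ha : 0 ≤ a) (d : ℕ) (h : a ^ (d + 1) ≤ r) :
    a ≤ r ^ (1 / ((d : ℝ) + 1)) := by
  have hr : 0 ≤ r := le_trans (by positivity) h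
  refine le_of_pow_le_pow_left₀ (n := d + 1) (by omega) (by positivity) ?_
  rwa [rpow_root_pow hr]

theorem rpow_root_le {r a : ℝ} (hr : 0 ≤ r) (ha : 0 ≤ a) (d : ℕ) (h : r ≤ a ^ (d + 1)) :
    r ^ (1 / ((d : ℝ) + 1)) ≤ a := by
  refine le_of_pow_le_pow_left₀ (n := d + 1) (by omega) ha ?_
  rwa [rpow_root_pow hr]

/-- The bounds that determine from which load on the scaled power is smooth. -/
theorem smoothAt_scaled_tail {d N₀ : ℕ} {r lo hi : ℝ} (hlo : 1 ≤ lo) (hlor : lo ^ (d + 1) ≤ r)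
    (hr : r ≤ hi) (hN₀ : 0 < N₀)
    (h : ((N₀ : ℝ) + 1) ^ (d + 1) * (d + 2 - 1 / hi) ≤ (d + 1) * lo * (N₀ : ℝ) ^ (d + 1))
    {g : ℕ → ℝ} (hg : ∀ n, N₀ ≤ n → g n = r ^ (1 / ((d : ℝ) + 1)) * (n : ℝ) ^ d)
    {z n : ℕ} (hnz : N₀ ≤ n + z) (m : ℕ) : SmoothAt d r g z n m := by
  have h1 : 1 ≤ r := le_trans (one_le_pow₀ hlo) hlor
  have hν := le_rpow_root (by linarith) d hlor
  have := smooth_scaled_pow (d := d) (r := r) (ν := r ^ (1 / ((d : ℝ) + 1))) (by linarith)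
    (rpow_root_pow (by linarith) d).symm (N := n + z) (z := z) (n := n) (m := m) rfl
    (gap_of_le (by linarith) hr hν hN₀ hnz (by linarith) h)
  unfold SmoothAt
  rw [hg _ hnz, hg _ (by omega)]
  push_cast at this ⊢
  exact this

/-! ### Lower bounds for the optimal values -/

section Feasible

variable {K d : ℕ} {r : ℝ} {g : ℕ → ℝ}

/-- The constraint with `n - 1` frozen players, one other player and `m = 0`; the next lemma is the
one with no other player and `m = 1`. -/
theorem LPFeasible.pow_le (h : LPFeasible K d r g) {n : ℕ} (hn : n < K) (h0 : 0 < n) :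
    (n : ℝ) ^ d ≤ g n := by
  have := h.1 1 (n - 1) 0 (by omega) (by omega)
  have e : 1 + (n - 1) = n := by omega
  simp only [SmoothAt, powerSum_succ, powerSum_zero, e] at this
  have e2 : ((n - 1 : ℕ) : ℝ) + 1 = n := by rw [Nat.cast_sub (by omega)]; simp
  simpa [e2] using this

theorem LPFeasible.le_pow (h : LPFeasible K d r g) {n : ℕ} (hn : n < K) :
    g (n + 1) ≤ r * ((n : ℝ) + 1) ^ d := by
  have := h.1 0 n 1 (by omega) (by nlinarith)
  simp only [SmoothAt, powerSum_succ, powerSum_zero] at this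
  simpa using this

theorem LPFeasible.one_le (h : LPFeasible K d r g) (hK : 1 < K) : 1 ≤ r := by
  have h1 := h.pow_le (n := 1) hK (by omega)
  have h2 := h.le_pow (n := 0) (by omega)
  simp at h1 h2
  linarith

/-- The smoothness inequality at load `n` without frozen players. -/
theorem LPFeasible.chain (h : LPFeasible 150 d r g) (n m : ℕ) (hn : n < 150) (hm : m ≤ 2) :
    powerSum d 0 n ≤ r * powerSum d 0 m - m * g (n + 1) + n * g n := by
  have := h.1 n 0 m (by omega) (by omega)
  simpa [SmoothAt] using this

end Feasible

theorem bddBelow_LPValues (d : ℕ) : BddBelow (LPValues d) :=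
  ⟨1, fun _ ⟨_, h⟩ => h.one_le (by norm_num)⟩

/-- Each constraint bounds a value of `g` by the preceding one, and the last is compared with `n ^ d
≤ g n`. Eliminating `g` gives `r ≥ 29 / 18` here. The bounds for the other degrees are chains of the
same kind; for degree 2 the chain yields exactly `67 / 20`. -/
theorem LPValues_lower_one {r : ℝ} (h : r ∈ LPValues 1) : 1.611 ≤ r := by
  obtain ⟨g, h⟩ := h
  have h0 := h.chain 0 1 (by norm_num) (by norm_num)
  have h1 := h.chain 1 1 (by norm_num) (by norm_num)
  have h2 := h.chain 2 1 (by norm_num) (by norm_num)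
  have h3 := h.chain 3 2 (by norm_num) (by norm_num)
  have h4 := h.pow_le (n := 4) (by norm_num) (by norm_num)
  norm_num [powerSum_succ] at h0 h1 h2 h3 h4
  linarith

theorem LPValues_lower_two {r : ℝ} (h : r ∈ LPValues 2) : 3.35 ≤ r := by
  obtain ⟨g, h⟩ := h
  have h0 := h.chain 0 1 (by norm_num) (by norm_num)
  have h1 := h.chain 1 1 (by norm_num) (by norm_num)
  have h2 := h.chain 2 1 (by norm_num) (by norm_num)
  have h3 := h.chain 3 2 (by norm_num) (by norm_num)
  have h4 := h.pow_le (n := 4) (by norm_num) (by norm_num)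
  norm_num [powerSum_succ] at h0 h1 h2 h3 h4
  linarith

theorem LPValues_lower_three {r : ℝ} (h : r ∈ LPValues 3) : 8.575 ≤ r := by
  obtain ⟨g, h⟩ := h
  have h0 := h.chain 0 1 (by norm_num) (by norm_num)
  have h1 := h.chain 1 1 (by norm_num) (by norm_num)
  have h2 := h.chain 2 1 (by norm_num) (by norm_num)
  have h3 := h.chain 3 1 (by norm_num) (by norm_num)
  have h4 := h.chain 4 2 (by norm_num) (by norm_num)
  have h5 := h.pow_le (n := 5) (by norm_num) (by norm_num)
  norm_num [powerSum_succ] at h0 h1 h2 h3 h4 h5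
  linarith

theorem LPValues_lower_four {r : ℝ} (h : r ∈ LPValues 4) : 27.456 ≤ r := by
  obtain ⟨g, h⟩ := h
  have h0 := h.chain 0 1 (by norm_num) (by norm_num)
  have h1 := h.chain 1 1 (by norm_num) (by norm_num)
  have h2 := h.chain 2 1 (by norm_num) (by norm_num)
  have h3 := h.chain 3 1 (by norm_num) (by norm_num)
  have h4 := h.chain 4 2 (by norm_num) (by norm_num)
  have h5 := h.pow_le (n := 5) (by norm_num) (by norm_num)
  norm_num [powerSum_succ] at h0 h1 h2 h3 h4 h5
  linarith

theorem LPValues_lower_five {r : ℝ} (h : r ∈ LPValues 5) : 98.137 ≤ r := by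
  obtain ⟨g, h⟩ := h
  have h0 := h.chain 0 1 (by norm_num) (by norm_num)
  have h1 := h.chain 1 1 (by norm_num) (by norm_num)
  have h2 := h.chain 2 1 (by norm_num) (by norm_num)
  have h3 := h.chain 3 1 (by norm_num) (by norm_num)
  have h4 := h.chain 4 2 (by norm_num) (by norm_num)
  have h5 := h.chain 5 2 (by norm_num) (by norm_num)
  have h6 := h.pow_le (n := 6) (by norm_num) (by norm_num)
  norm_num [powerSum_succ] at h0 h1 h2 h3 h4 h5 h6
  linarith

/-! ### Upper bounds for the optimal values from explicit tables -/

/-- `powerSum` with natural number values, for evaluation. -/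
def natPowerSum (d z : ℕ) : ℕ → ℕ
  | 0 => 0
  | m + 1 => natPowerSum d z m + (z + m + 1) ^ d

theorem cast_natPowerSum (d z m : ℕ) : (natPowerSum d z m : ℝ) = powerSum d z m := by
  induction m with
  | zero => simp [natPowerSum]
  | succ m ih => rw [natPowerSum, powerSum_succ, ← ih]; push_cast; ring

/-- The smoothness inequality for `r = a / 1000` and the values `T n / b`. -/
def tableSmooth (d a b : ℕ) (T : ℕ → ℕ) (z n m : ℕ) : Prop :=
  1000 * b * natPowerSum d z n + 1000 * m * T (n + z + 1) ≤
    b * a * natPowerSum d z m + 1000 * n * T (n + z)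

instance (d a b : ℕ) (T : ℕ → ℕ) (z n m : ℕ) : Decidable (tableSmooth d a b T z n m) :=
  inferInstanceAs (Decidable (_ ≤ _))

/-- A table of values below the load `N₀`, continued by the scaled power, is feasible. The entry of
the table at `N₀` is an upper bound for the scaled power. -/
theorem mem_LPValues_of_table {d N₀ a b : ℕ} {lo hi : ℝ} (T : ℕ → ℕ) (hb : 0 < b)
    (hN₀ : 0 < N₀) (hN₀' : N₀ ≤ 150)
    (hT : ∀ n < N₀, ∀ z < N₀, ∀ m < N₀, n + z < N₀ → m ≤ n → tableSmooth d a b T z n m)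
    (hT' : ∀ n < N₀, 1000 * T (n + 1) ≤ b * a * (n + 1) ^ d)
    (hlo : 1 ≤ lo) (hlor : lo ^ (d + 1) ≤ a / 1000) (hhi : 0 ≤ hi)
    (hr : (a / 1000 : ℝ) ≤ hi ^ (d + 1)) (hTN : hi * (N₀ : ℝ) ^ d ≤ T N₀ / b)
    (h : ((N₀ : ℝ) + 1) ^ (d + 1) * (d + 2 - 1 / (a / 1000)) ≤ (d + 1) * lo * (N₀ : ℝ) ^ (d + 1)) :
    (a / 1000 : ℝ) ∈ LPValues d := by
  -- Here `lo` and `hi` enclose the root `ν`; `hi` serves only to dominate the scaled power at `N₀`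
  -- by the table entry there.
  set r : ℝ := a / 1000 with hrdef
  have hr0 : 0 ≤ r := by positivity
  have hbR : (0 : ℝ) < b := by exact_mod_cast hb
  set g : ℕ → ℝ := fun n => if n < N₀ then T n / b else r ^ (1 / ((d : ℝ) + 1)) * (n : ℝ) ^ d
    with hg
  have hg1 : ∀ n < N₀, g n = T n / b := fun n hn => by simp [hg, hn]
  have hg2 : ∀ n, N₀ ≤ n → g n = r ^ (1 / ((d : ℝ) + 1)) * (n : ℝ) ^ d :=
    fun n hn => by simp [hg, hn]
  have hg3 : ∀ n ≤ N₀, g n ≤ T n / b := by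
    intro n hn
    rcases hn.lt_or_eq with hn | rfl
    · exact (hg1 n hn).le
    · rw [hg2 _ le_rfl]
      refine le_trans ?_ hTN
      gcongr
      exact rpow_root_le hr0 hhi d hr
  refine ⟨g, fun n z m hnz _ => ?_, (hg2 150 hN₀').ge, fun n _ => ?_⟩
  · by_cases hs : n + z < N₀
    · have key : ∀ m ≤ n, SmoothAt d r g z n m := by
        intro m hm
        have h1 := hT n (by omega) z (by omega) m (by omega) hs hm
        have h2 : (1000 * b * powerSum d z n + 1000 * m * T (n + z + 1) : ℝ) ≤
            b * a * powerSum d z m + 1000 * n * T (n + z) := by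
          rw [← cast_natPowerSum, ← cast_natPowerSum]; exact_mod_cast h1
        have h3 : (m : ℝ) * g (n + z + 1) ≤ m * (T (n + z + 1) / b) := by
          gcongr; exact hg3 _ hs
        unfold SmoothAt
        rw [hg1 _ hs]
        refine le_trans ?_ (sub_le_sub_left h3 _ |> fun h => add_le_add_left h _)
        rw [← sub_nonneg] at h2 ⊢
        have e : r * powerSum d z m - m * (T (n + z + 1) / b : ℝ) + n * (T (n + z) / b) -
            powerSum d z n = (b * a * powerSum d z m + 1000 * n * T (n + z) -
              (1000 * b * powerSum d z n + 1000 * m * T (n + z + 1))) / (1000 * b) := by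
          rw [hrdef]; field_simp; ring
        rw [e]; positivity
      rcases le_total m n with hm | hm
      · exact key m hm
      -- Only `m ≤ n` has to be in the finite check: at `m = n` the next summand already dominates
      -- `g (n + z + 1)`.
      · refine SmoothAt.of_le (m := n) hr0 (key n le_rfl) ((hg3 _ hs).trans ?_) hm
        have h1 : (1000 * T (n + z + 1) : ℝ) ≤ b * a * ((n + z : ℕ) + 1) ^ d := by
          exact_mod_cast hT' (n + z) hs
        rw [div_le_iff₀ hbR, hrdef]
        push_cast at h1
        rw [add_comm (z : ℝ)]
        linarith
    · exact smoothAt_scaled_tail hlo hlor le_rfl hN₀ h hg2 (by omega) m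
  · by_cases hn : n < N₀
    · rw [hg1 n hn]; positivity
    · rw [hg2 n (by omega)]; positivity

/-- Numerators over 200. Beyond the listed entries, `323 * n` is the largest value `r n` that
feasibility allows for `r = 1.615`. -/
def tableOne (n : ℕ) : ℕ :=
  [0, 323, 446, 615, 807, 1055, 1376, 1780, 2272, 2825].getD n (323 * n)

/-- Numerators over 20, and over 50 in the next three tables. The last listed entry belongs to the
load `N₀` where the scaled power takes over, so the default `0` is never read. -/
def tableTwo (n : ℕ) : ℕ :=
  [0, 67, 114, 195, 320, 507, 791, 1234, 1905, 2877, 4226, 5964, 8129, 10679, 13147, 15093,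
    17172].getD n 0

def tableThree (n : ℕ) : ℕ :=
  [0, 429, 808, 1595, 3414, 6258, 11828, 21454, 38469, 67895, 116499, 192868, 307466].getD n 0

def tableFour (n : ℕ) : ℕ :=
  [0, 1373, 2696, 5915, 14218, 31256, 65335, 137604, 287994, 587848, 1173629].getD n 0

def tableFive (n : ℕ) : ℕ :=
  [0, 4907, 9764, 22785, 59462, 167389, 388813, 942379, 2166861, 5156297, 11686130].getD n 0

theorem LPValues_upper_one : (1615 / 1000 : ℝ) ∈ LPValues 1 := by
  have := mem_LPValues_of_table (d := 1) (N₀ := 31) (a := 1615) (b := 200) (lo := 1.269)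
    (hi := 1.271) tableOne (by norm_num) (by norm_num) (by norm_num) (by decide +kernel)
    (by decide +kernel) (by norm_num) (by norm_num) (by norm_num) (by norm_num)
    (by norm_num [tableOne]) (by norm_num)
  exact_mod_cast this

theorem LPValues_upper_two : (3354 / 1000 : ℝ) ∈ LPValues 2 := by
  have := mem_LPValues_of_table (d := 2) (N₀ := 16) (a := 3354) (b := 20) (lo := 1.496)
    (hi := 1.497) tableTwo (by norm_num) (by norm_num) (by norm_num) (by decide +kernel)
    (by decide +kernel) (by norm_num) (by norm_num) (by norm_num) (by norm_num)
    (by norm_num [tableTwo]) (by norm_num)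
  exact_mod_cast this

theorem LPValues_upper_three : (8580 / 1000 : ℝ) ∈ LPValues 3 := by
  have := mem_LPValues_of_table (d := 3) (N₀ := 12) (a := 8580) (b := 50) (lo := 1.711)
    (hi := 1.712) tableThree (by norm_num) (by norm_num) (by norm_num) (by decide +kernel)
    (by decide +kernel) (by norm_num) (by norm_num) (by norm_num) (by norm_num)
    (by norm_num [tableThree]) (by norm_num)
  exact_mod_cast this

theorem LPValues_upper_four : (27460 / 1000 : ℝ) ∈ LPValues 4 := by
  have := mem_LPValues_of_table (d := 4) (N₀ := 10) (a := 27460) (b := 50) (lo := 1.939)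
    (hi := 1.94) tableFour (by norm_num) (by norm_num) (by norm_num) (by decide +kernel)
    (by decide +kernel) (by norm_num) (by norm_num) (by norm_num) (by norm_num)
    (by norm_num [tableFour]) (by norm_num)
  exact_mod_cast this

theorem LPValues_upper_five : (98140 / 1000 : ℝ) ∈ LPValues 5 := by
  have := mem_LPValues_of_table (d := 5) (N₀ := 10) (a := 98140) (b := 50) (lo := 2.147)
    (hi := 2.148) tableFive (by norm_num) (by norm_num) (by norm_num) (by decide +kernel)
    (by decide +kernel) (by norm_num) (by norm_num) (by norm_num) (by norm_num)
    (by norm_num [tableFive]) (by norm_num)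
  exact_mod_cast this

/-! ### Extension of feasible solutions to all loads -/

section Extend

variable {d : ℕ} {r : ℝ} {g : ℕ → ℝ}

/-- A feasible `g` stays smooth when it is continued by the scaled power from `150` on. -/
theorem LPFeasible.smoothAt_extend {lo hi : ℝ} (h : LPFeasible 150 d r g) (hlo : 1 ≤ lo)
    (hlor : lo ^ (d + 1) ≤ r) (hr : r ≤ hi)
    (hgap : ((150 : ℝ) + 1) ^ (d + 1) * (d + 2 - 1 / hi) ≤ (d + 1) * lo * (150 : ℝ) ^ (d + 1))
    {g' : ℕ → ℝ} (hg : ∀ n < 150, g' n = g n)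
    (hg' : ∀ n, 150 ≤ n → g' n = r ^ (1 / ((d : ℝ) + 1)) * (n : ℝ) ^ d) (z n m : ℕ) :
    SmoothAt d r g' z n m := by
  by_cases hnz : n + z < 150
  · have h1 : 1 ≤ r := h.one_le (by norm_num)
    -- At the seam `n + z = 149` the value at 150 is the scaled power instead of `g 150`. It enters
    -- with the factor `-m`, so the last constraint of the program has the right direction.
    have hle : g' (n + z + 1) ≤ g (n + z + 1) := by
      rcases (show n + z + 1 ≤ 150 from hnz).lt_or_eq with h' | h'
      · exact (hg _ h').le
      · rw [h', hg' _ le_rfl]; exact h.2.1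
    have key : ∀ m ≤ (150 + 1) ^ 2 * (d + 1), SmoothAt d r g' z n m := by
      intro m hm
      have := h.1 n z m hnz hm
      unfold SmoothAt at *
      rw [hg _ hnz]
      have : (m : ℝ) * g' (n + z + 1) ≤ m * g (n + z + 1) := by gcongr
      linarith
    -- The program covers `m ≤ n` amply; larger `m` follow from `m = n` by monotonicity.
    rcases le_total m n with hm | hm
    · exact key m (by nlinarith)
    · refine SmoothAt.of_le (m := n) (by linarith) (key n (by nlinarith)) ?_ hm
      have := h.le_pow hnz
      push_cast at this
      rw [add_comm (z : ℝ)]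
      linarith
  · exact smoothAt_scaled_tail hlo hlor hr (N₀ := 150) (by norm_num) (by exact_mod_cast hgap) hg'
      (by omega) m

end Extend

/-! ### Attainment of the minimum and numerical values -/

theorem isClosed_smoothAt (d z n m : ℕ) :
    IsClosed {x : ℝ × (ℕ → ℝ) | SmoothAt d x.1 x.2 z n m} := by
  unfold SmoothAt
  exact isClosed_le (by fun_prop) (by fun_prop)

theorem isClosed_LPFeasible (K d : ℕ) : IsClosed {x : ℝ × (ℕ → ℝ) | LPFeasible K d x.1 x.2} := by
  have e : {x : ℝ × (ℕ → ℝ) | LPFeasible K d x.1 x.2} =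
      (⋂ (n : ℕ) (z : ℕ) (m : ℕ) (_ : n + z < K) (_ : m ≤ (K + 1) ^ 2 * (d + 1)),
        {x : ℝ × (ℕ → ℝ) | SmoothAt d x.1 x.2 z n m}) ∩
      ({x : ℝ × (ℕ → ℝ) | x.1 ^ (1 / ((d : ℝ) + 1)) * (K : ℝ) ^ d ≤ x.2 K} ∩
        ⋂ (n : ℕ) (_ : n ≤ K), {x : ℝ × (ℕ → ℝ) | 0 ≤ x.2 n}) := by
    ext x
    simp [LPFeasible]
  rw [e]
  refine IsClosed.inter ?_ (IsClosed.inter ?_ ?_)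
  · exact isClosed_iInter fun n => isClosed_iInter fun z => isClosed_iInter fun m =>
      isClosed_iInter fun _ => isClosed_iInter fun _ => isClosed_smoothAt d z n m
  · refine isClosed_le (Continuous.mul ?_ continuous_const) (by fun_prop)
    exact (Real.continuous_rpow_const (by positivity)).comp continuous_fst
  · exact isClosed_iInter fun n => isClosed_iInter fun _ => isClosed_le (by fun_prop) (by fun_prop)

/-- Feasibility does not depend on the values at `0` and beyond `K`. -/
theorem LPFeasible.truncate {K d : ℕ} {r : ℝ} {g : ℕ → ℝ} (h : LPFeasible K d r g) (hK : 0 < K) :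
    LPFeasible K d r fun n => if 1 ≤ n ∧ n ≤ K then g n else 0 := by
  refine ⟨fun n z m hnz hm => ?_, ?_, fun n hn => ?_⟩
  · have := h.1 n z m hnz hm
    unfold SmoothAt at *
    dsimp only
    rw [if_pos ⟨by omega, by omega⟩]
    rcases Nat.eq_zero_or_pos n with rfl | hn
    · simpa using this
    · rwa [if_pos ⟨by omega, by omega⟩]
  · dsimp only
    rw [if_pos ⟨hK, le_rfl⟩]; exact h.2.1
  · dsimp only
    split_ifs
    · exact h.2.2 n hn
    · exact le_rfl

/-- Values above a feasible `R` are irrelevant, and a truncated `g` lies in the product of the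
intervals `[0, R n ^ d]`. This box is compact and the constraints are closed, so the projection to
`r` attains its minimum. -/
theorem isLeast_rho {d : ℕ} {R : ℝ} (hR : R ∈ LPValues d) : IsLeast (LPValues d) (rho d) := by
  have hbdd := bddBelow_LPValues d
  set C : Set (ℝ × (ℕ → ℝ)) := {x | LPFeasible 150 d x.1 x.2} ∩
    (Set.Icc 0 R ×ˢ Set.univ.pi fun n : ℕ => Set.Icc 0 (R * (n : ℝ) ^ d)) with hC
  have hcomp : IsCompact C :=
    (isCompact_Icc.prod (isCompact_univ_pi fun _ => isCompact_Icc)).inter_left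
      (isClosed_LPFeasible 150 d)
  have himg : ∀ r ∈ LPValues d, r ≤ R → r ∈ Prod.fst '' C := by
    rintro r ⟨g, hg⟩ hr
    have h1 : 1 ≤ r := hg.one_le (by norm_num)
    refine ⟨(r, fun n => if 1 ≤ n ∧ n ≤ 150 then g n else 0), ⟨hg.truncate (by norm_num), ?_⟩, rfl⟩
    refine ⟨⟨by linarith, hr⟩, fun n _ => ?_⟩
    have hR0 : 0 ≤ R := by linarith
    by_cases hn : 1 ≤ n ∧ n ≤ 150
    · simp only [if_pos hn]
      refine ⟨hg.2.2 n hn.2, ?_⟩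
      obtain ⟨k, rfl⟩ : ∃ k, n = k + 1 := ⟨n - 1, by omega⟩
      refine (hg.le_pow (by omega)).trans ?_
      push_cast
      gcongr
    · simp only [if_neg hn]
      exact ⟨le_rfl, by positivity⟩
  obtain ⟨r, hr, hmin⟩ := (hcomp.image continuous_fst).exists_isLeast ⟨R, himg R hR le_rfl⟩
  have hleast : IsLeast (LPValues d) r := by
    obtain ⟨x, hx, rfl⟩ := hr
    refine ⟨⟨x.2, hx.1⟩, fun r' hr' => ?_⟩
    rcases le_total r' R with h | h
    · exact hmin (himg r' hr' h)
    · exact hx.2.1.2.trans h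
  have : rho d = r := hleast.csInf_eq
  rwa [this]

theorem rho_bounds_one : 1.611 ≤ rho 1 ∧ rho 1 ≤ 1.615 :=
  ⟨LPValues_lower_one (isLeast_rho LPValues_upper_one).1,
    (csInf_le (bddBelow_LPValues 1) LPValues_upper_one).trans (by norm_num)⟩

theorem rho_bounds_two : 3.35 ≤ rho 2 ∧ rho 2 ≤ 3.354 :=
  ⟨LPValues_lower_two (isLeast_rho LPValues_upper_two).1,
    (csInf_le (bddBelow_LPValues 2) LPValues_upper_two).trans (by norm_num)⟩

theorem rho_bounds_three : 8.575 ≤ rho 3 ∧ rho 3 ≤ 8.58 :=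
  ⟨LPValues_lower_three (isLeast_rho LPValues_upper_three).1,
    (csInf_le (bddBelow_LPValues 3) LPValues_upper_three).trans (by norm_num)⟩

theorem rho_bounds_four : 27.456 ≤ rho 4 ∧ rho 4 ≤ 27.46 :=
  ⟨LPValues_lower_four (isLeast_rho LPValues_upper_four).1,
    (csInf_le (bddBelow_LPValues 4) LPValues_upper_four).trans (by norm_num)⟩

theorem rho_bounds_five : 98.137 ≤ rho 5 ∧ rho 5 ≤ 98.14 :=
  ⟨LPValues_lower_five (isLeast_rho LPValues_upper_five).1,
    (csInf_le (bddBelow_LPValues 5) LPValues_upper_five).trans (by norm_num)⟩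

theorem isLeast_rho_of_mem {d : ℕ} (hd : d ∈ Finset.Icc 1 5) : IsLeast (LPValues d) (rho d) := by
  fin_cases hd
  · exact isLeast_rho LPValues_upper_one
  · exact isLeast_rho LPValues_upper_two
  · exact isLeast_rho LPValues_upper_three
  · exact isLeast_rho LPValues_upper_four
  · exact isLeast_rho LPValues_upper_five

/-- Read off from the numerical enclosures. It is needed because a polynomial mixes degrees, all of
which must be smooth with the same factor. -/
theorem rho_mono {j d : ℕ} (hj : j ∈ Finset.Icc 1 d) (hd : d ∈ Finset.Icc 1 5) :
    rho j ≤ rho d := by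
  have h1 := rho_bounds_one
  have h2 := rho_bounds_two
  have h3 := rho_bounds_three
  have h4 := rho_bounds_four
  have h5 := rho_bounds_five
  rw [Finset.mem_Icc] at hj hd
  obtain ⟨hd1, hd5⟩ := hd
  obtain ⟨hj1, hjd⟩ := hj
  interval_cases d <;> interval_cases j <;> linarith

theorem one_lt_rho {d : ℕ} (hd : d ∈ Finset.Icc 1 5) : 1 < rho d := by
  have h1 := rho_bounds_one
  have := rho_mono (j := 1) (d := d) (by simp at hd ⊢; omega) hd
  linarith

/-- In each case `lo` is a lower bound for the root `ν`, whereas `hi` is an upper bound for `rho d`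
itself; what remains is a rational inequality at load 150. -/
theorem smoothAt_extendCost {d : ℕ} (hd : d ∈ Finset.Icc 1 5) {g : ℕ → ℝ}
    (h : LPFeasible 150 d (rho d) g) (z n m : ℕ) :
    SmoothAt d (rho d) (extendCost d g) z n m := by
  have e1 : ∀ n < 150, extendCost d g n = g n := fun n hn => by simp [extendCost, hn]
  have e2 : ∀ n, 150 ≤ n → extendCost d g n = rho d ^ (1 / ((d : ℝ) + 1)) * (n : ℝ) ^ d :=
    fun n hn => by rw [extendCost, if_neg (by omega)]
  have h1 := rho_bounds_one
  have h2 := rho_bounds_two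
  have h3 := rho_bounds_three
  have h4 := rho_bounds_four
  have h5 := rho_bounds_five
  fin_cases hd
  · exact h.smoothAt_extend (lo := 1.269) (hi := 1.615) (by norm_num)
      (le_trans (by norm_num) h1.1) h1.2 (by norm_num) e1 e2 z n m
  · exact h.smoothAt_extend (lo := 1.496) (hi := 3.354) (by norm_num)
      (le_trans (by norm_num) h2.1) h2.2 (by norm_num) e1 e2 z n m
  · exact h.smoothAt_extend (lo := 1.711) (hi := 8.58) (by norm_num)
      (le_trans (by norm_num) h3.1) h3.2 (by norm_num) e1 e2 z n m
  · exact h.smoothAt_extend (lo := 1.939) (hi := 27.46) (by norm_num)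
      (le_trans (by norm_num) h4.1) h4.2 (by norm_num) e1 e2 z n m
  · exact h.smoothAt_extend (lo := 2.147) (hi := 98.14) (by norm_num)
      (le_trans (by norm_num) h5.1) h5.2 (by norm_num) e1 e2 z n m

/-! ### Strong smoothness of polynomial costs -/

/-- `f'` is a strongly `ρ`-smooth modification of the resource cost `f`. -/
def StronglySmooth (ρ : ℝ) (f f' : ℕ → ℝ) : Prop :=
  ∀ z n m : ℕ, intervalSum f z n ≤ ρ * intervalSum f z m - m * f' (n + z + 1) + n * f' (n + z)

/-- The inequality with `n - 1` frozen players, one player in the first state and none in the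
second; the next lemma exchanges the two states. -/
theorem StronglySmooth.le {ρ : ℝ} {f f' : ℕ → ℝ} (h : StronglySmooth ρ f f') {n : ℕ}
    (hn : 0 < n) : f n ≤ f' n := by
  have := h (n - 1) 1 0
  rw [intervalSum_succ] at this
  have e : n - 1 + 1 = n := by omega
  have e' : 1 + (n - 1) = n := by omega
  simpa [e, e'] using this

theorem StronglySmooth.le_mul {ρ : ℝ} {f f' : ℕ → ℝ} (h : StronglySmooth ρ f f') {n : ℕ}
    (hn : 0 < n) : f' n ≤ ρ * f n := by
  have := h (n - 1) 0 1
  rw [intervalSum_succ] at this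
  have e : n - 1 + 1 = n := by omega
  simpa [e] using this

/-- Smoothness is linear in the pair of cost functions, so non-negative combinations of monomials
inherit it. The constant term, which is not modified, only needs `ρ ≥ 1`. -/
theorem stronglySmooth_modifiedCost {d : ℕ} (hd : d ∈ Finset.Icc 1 5) {g : ℕ → ℕ → ℝ}
    (hg : ∀ j ∈ Finset.Icc 1 d, LPFeasible 150 j (rho j) (g j)) {P : Polynomial ℝ}
    (hP : P.natDegree ≤ d) (hP0 : ∀ j, 0 ≤ P.coeff j) :
    StronglySmooth (rho d) (fun n => P.eval (n : ℝ)) (modifiedCost d g P) := by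
  intro z n m
  have hsum : ∀ z n : ℕ, intervalSum (fun n => P.eval (n : ℝ)) z n =
      P.coeff 0 * n + ∑ j ∈ Finset.Icc 1 d, P.coeff j * powerSum j z n := by
    intro z n
    have h1 : ∀ x : ℝ, P.eval x = P.coeff 0 + ∑ j ∈ Finset.Icc 1 d, P.coeff j * x ^ j := by
      intro x
      rw [Polynomial.eval_eq_sum_range' (n := d + 1) (by omega), Finset.range_eq_Ico,
        Finset.sum_eq_sum_Ico_succ_bot (by omega)]
      simp only [pow_zero, mul_one]
      rfl
    simp only [intervalSum, h1, Finset.sum_add_distrib, powerSum, Finset.mul_sum]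
    rw [Finset.sum_comm]
    simp [mul_comm]
  have key : ∀ j ∈ Finset.Icc 1 d, P.coeff j * powerSum j z n ≤
      rho d * (P.coeff j * powerSum j z m) - m * (P.coeff j * extendCost j (g j) (n + z + 1)) +
        n * (P.coeff j * extendCost j (g j) (n + z)) := by
    intro j hj
    have hj5 : j ∈ Finset.Icc 1 5 := by simp at hj hd ⊢; omega
    have := (smoothAt_extendCost hj5 (hg j hj) z n m).mono (rho_mono hj hd)
    have := mul_le_mul_of_nonneg_left this (hP0 j)
    linarith
  have h0 : P.coeff 0 * n ≤ rho d * (P.coeff 0 * m) - m * P.coeff 0 + n * P.coeff 0 := by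
    have : 0 ≤ (rho d - 1) * (P.coeff 0 * m) := by
      have := (one_lt_rho hd).le
      have := hP0 0
      apply mul_nonneg <;> [linarith; positivity]
    linarith
  have := Finset.sum_le_sum key
  simp only [Finset.sum_add_distrib, Finset.sum_sub_distrib, ← Finset.mul_sum] at this
  rw [hsum, hsum, modifiedCost, modifiedCost]
  linarith

theorem intervalSum_nonneg {f : ℕ → ℝ} (hf : ∀ n, 0 < n → 0 ≤ f n) (z n : ℕ) :
    0 ≤ intervalSum f z n :=
  Finset.sum_nonneg fun i hi => hf i (by simp at hi; omega)

theorem intervalSum_le_mul {f f' : ℕ → ℝ} {ρ : ℝ} (h : ∀ n, 0 < n → f' n ≤ ρ * f n) (z n : ℕ) :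
    intervalSum f' z n ≤ ρ * intervalSum f z n := by
  unfold intervalSum
  rw [Finset.mul_sum]
  exact Finset.sum_le_sum fun i hi => h i (by simp at hi; omega)

/-! ### Rosenthal's potential and the shares of sets of players -/

section Potential

variable {ι E : Type} [Fintype ι] [DecidableEq ι] [Fintype E] [DecidableEq E]

/-- Rosenthal's potential for the resource costs `f`. -/
def potential (f : E → ℕ → ℝ) (s : ι → Finset E) : ℝ := ∑ e, intervalSum (f e) 0 (load s e)

/-- The state in which only the players in `S` participate. -/
def restrictTo (S : Finset ι) (s : ι → Finset E) : ι → Finset E := fun u => if u ∈ S then s u else ∅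

@[simp] theorem restrictTo_univ (s : ι → Finset E) : restrictTo Finset.univ s = s := by
  ext u; simp [restrictTo]

theorem restrictTo_congr {S : Finset ι} {s s' : ι → Finset E} (h : ∀ u ∈ S, s u = s' u) :
    restrictTo S s = restrictTo S s' := by
  funext v
  by_cases hv : v ∈ S <;> simp [restrictTo, hv]
  rw [h v hv]

theorem restrictTo_erase (S : Finset ι) (u : ι) (s : ι → Finset E) :
    restrictTo (S.erase u) s = Function.update (restrictTo S s) u ∅ := by
  funext v
  by_cases hv : v = u
  · subst hv; simp [restrictTo]
  · simp [restrictTo, hv]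

theorem load_eq_update_empty (s : ι → Finset E) (u : ι) (e : E) :
    load s e = load (Function.update s u ∅) e + if e ∈ s u then 1 else 0 := by
  unfold load
  have h : (Finset.univ.filter fun v => e ∈ Function.update s u ∅ v) =
      (Finset.univ.filter fun v => e ∈ s v).erase u := by
    ext v
    by_cases hv : v = u
    · subst hv; simp
    · simp [hv]
  rw [h]
  split_ifs with hu
  · rw [Finset.card_erase_add_one (by simpa using hu)]
  · rw [Finset.erase_eq_of_notMem (by simpa using hu), add_zero]

theorem load_mono {s s' : ι → Finset E} (h : ∀ u, s u ⊆ s' u) (e : E) : load s e ≤ load s' e :=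
  Finset.card_le_card fun u => by simpa using fun hu => h u hu

theorem load_le_card (s : ι → Finset E) (e : E) : load s e ≤ Fintype.card ι :=
  Finset.card_le_univ _

theorem load_pos {s : ι → Finset E} {u : ι} {e : E} (h : e ∈ s u) : 0 < load s e :=
  Finset.card_pos.2 ⟨u, by simpa using h⟩

/-- A player counted last on each of its resources contributes exactly its own cost. Rosenthal's
identity is the difference of two such equations. -/
theorem potential_eq_update_empty (f : E → ℕ → ℝ) (s : ι → Finset E) (u : ι) :
    potential f s = potential f (Function.update s u ∅) + playerCost f s u := by
  unfold potential playerCost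
  have : ∑ e ∈ s u, f e (load s e) = ∑ e, if e ∈ s u then f e (load s e) else 0 := by
    rw [Finset.sum_ite_mem, Finset.univ_inter]
  rw [this, ← Finset.sum_add_distrib]
  refine Finset.sum_congr rfl fun e _ => ?_
  have h := load_eq_update_empty s u e
  split_ifs at h ⊢ with hu
  · rw [h, intervalSum_succ, zero_add]
  · rw [h]; simp

theorem potential_update_sub (f : E → ℕ → ℝ) (s : ι → Finset E) (u : ι) (t : Finset E) :
    potential f (Function.update s u t) - potential f s =
      playerCost f (Function.update s u t) u - playerCost f s u := by
  have h1 := potential_eq_update_empty f s u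
  have h2 := potential_eq_update_empty f (Function.update s u t) u
  rw [Function.update_idem] at h2
  linarith

theorem potential_mono {f : E → ℕ → ℝ} (hf : ∀ e n, 0 < n → 0 ≤ f e n) {s s' : ι → Finset E}
    (h : ∀ u, s u ⊆ s' u) : potential f s ≤ potential f s' := by
  refine Finset.sum_le_sum fun e _ => ?_
  obtain ⟨k, hk⟩ := Nat.exists_eq_add_of_le (load_mono h e)
  rw [hk, intervalSum_add]
  linarith [intervalSum_nonneg (hf e) (0 + load s e) k]

theorem restrictTo_subset {S S' : Finset ι} (h : S ⊆ S') (s : ι → Finset E) (u : ι) :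
    restrictTo S s u ⊆ restrictTo S' s u := by
  by_cases hu : u ∈ S
  · simp [restrictTo, hu, h hu]
  · simp [restrictTo, hu]

theorem restrictTo_subset_self (S : Finset ι) (s : ι → Finset E) (u : ι) :
    restrictTo S s u ⊆ s u := by
  by_cases hu : u ∈ S <;> simp [restrictTo, hu]

theorem playerCost_restrictTo_le {f : E → ℕ → ℝ} (hf : ∀ e, Monotone (f e)) {S : Finset ι} {u : ι}
    (hu : u ∈ S) (s : ι → Finset E) : playerCost f (restrictTo S s) u ≤ playerCost f s u := by
  unfold playerCost
  have : restrictTo S s u = s u := by simp [restrictTo, hu]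
  rw [this]
  exact Finset.sum_le_sum fun e _ => hf e (load_mono (restrictTo_subset_self S s) e)

/-- Removing the players in `W` lowers the potential by at most the sum of their costs. -/
theorem potential_le_sdiff_add {f : E → ℕ → ℝ} (hf : ∀ e, Monotone (f e)) (s : ι → Finset E)
    (S W : Finset ι) (hW : W ⊆ S) : potential f (restrictTo S s) ≤
      potential f (restrictTo (S \ W) s) + ∑ w ∈ W, playerCost f s w := by
  induction W using Finset.induction_on with
  | empty => simp
  | insert w W hw ih =>
    have h1 := ih ((Finset.subset_insert w W).trans hW)
    have h2 := potential_eq_update_empty f (restrictTo (S \ W) s) w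
    have hmem : w ∈ S \ W := Finset.mem_sdiff.2 ⟨hW (Finset.mem_insert_self w W), hw⟩
    have h3 := playerCost_restrictTo_le hf hmem s
    rw [← restrictTo_erase, ← Finset.sdiff_insert] at h2
    rw [Finset.sum_insert hw]
    linarith

/-- Removing the players in `W` lowers the potential at least by the costs that the players in `W`
have when each of them is alone. -/
theorem potential_sdiff_add_le {f : E → ℕ → ℝ} (hf : ∀ e, Monotone (f e)) (s : ι → Finset E)
    (S W : Finset ι) (hW : W ⊆ S) : potential f (restrictTo (S \ W) s) +
      ∑ w ∈ W, ∑ e ∈ s w, f e 1 ≤ potential f (restrictTo S s) := by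
  induction W using Finset.induction_on with
  | empty => simp
  | insert w W hw ih =>
    have h1 := ih ((Finset.subset_insert w W).trans hW)
    have h2 := potential_eq_update_empty f (restrictTo (S \ W) s) w
    have hmem : w ∈ S \ W := Finset.mem_sdiff.2 ⟨hW (Finset.mem_insert_self w W), hw⟩
    have h3 : ∑ e ∈ s w, f e 1 ≤ playerCost f (restrictTo (S \ W) s) w := by
      have e1 : restrictTo (S \ W) s w = s w := by rw [restrictTo, if_pos hmem]
      unfold playerCost
      rw [e1]
      exact Finset.sum_le_sum fun e he => hf e (load_pos (u := w) (by rwa [e1]))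
    rw [← restrictTo_erase, ← Finset.sdiff_insert] at h2
    rw [Finset.sum_insert hw]
    linarith

/-- A pointwise bound of costs carries over to differences of potentials. -/
theorem potential_sub_le_mul {f f' : E → ℕ → ℝ} {ρ : ℝ} (h : ∀ e n, 0 < n → f' e n ≤ ρ * f e n)
    {s s' : ι → Finset E} (hs : ∀ u, s u ⊆ s' u) :
    potential f' s' - potential f' s ≤ ρ * (potential f s' - potential f s) := by
  unfold potential
  rw [← Finset.sum_sub_distrib, ← Finset.sum_sub_distrib, Finset.mul_sum]
  refine Finset.sum_le_sum fun e _ => ?_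
  obtain ⟨k, hk⟩ := Nat.exists_eq_add_of_le (load_mono hs e)
  rw [hk, intervalSum_add, intervalSum_add]
  have := intervalSum_le_mul (h e) (0 + load s e) k
  linarith

theorem playerCost_le_sum_card {f : E → ℕ → ℝ} (hf : ∀ e, Monotone (f e)) (s : ι → Finset E)
    (u : ι) : playerCost f s u ≤ ∑ e ∈ s u, f e (Fintype.card ι) :=
  Finset.sum_le_sum fun e _ => hf e (load_le_card s e)

theorem sum_one_le_playerCost {f : E → ℕ → ℝ} (hf : ∀ e, Monotone (f e)) (s : ι → Finset E)
    (u : ι) : ∑ e ∈ s u, f e 1 ≤ playerCost f s u :=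
  Finset.sum_le_sum fun e he => hf e (load_pos he)

theorem playerCost_le_mul {f f' : E → ℕ → ℝ} {ρ : ℝ} (h : ∀ e n, 0 < n → f' e n ≤ ρ * f e n)
    (s : ι → Finset E) (u : ι) : playerCost f' s u ≤ ρ * playerCost f s u := by
  unfold playerCost
  rw [Finset.mul_sum]
  exact Finset.sum_le_sum fun e he => h e _ (load_pos he)

/-- Number of users of `e` in a state, split by membership in `R`. -/
theorem load_eq_filter_add (s : ι → Finset E) (R : Finset ι) (e : E) :
    load s e = load (restrictTo Rᶜ s) e + (R.filter fun u => e ∈ s u).card := by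
  unfold load
  rw [← Finset.card_union_of_disjoint]
  · congr 1
    ext u
    by_cases hu : u ∈ R <;> simp [restrictTo, hu]
  · rw [Finset.disjoint_left]
    intro u hu hu'
    simp at hu'
    simp [restrictTo, hu'] at hu

/-- The players in `R` have in `s`, with respect to the costs `f'`, together at most the cost
`δ + ` the cost of deviating one by one to `s'`. Then the potential of `R` in `s` is, up to `δ`, at
most `ρ` times the one in `s'`. -/
theorem potential_le_of_stronglySmooth {f f' : E → ℕ → ℝ} {ρ δ : ℝ} (hρ : 1 ≤ ρ)
    (hf : ∀ e n, 0 < n → 0 ≤ f e n) (hsm : ∀ e, StronglySmooth ρ (f e) (f' e))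
    (s s' : ι → Finset E) (R : Finset ι) (hs : ∀ u ∉ R, s' u = s u)
    (hdev : ∑ u ∈ R, (playerCost f' s u - playerCost f' (Function.update s u (s' u)) u) ≤ δ) :
    potential f s - potential f (restrictTo Rᶜ s) ≤
      ρ * (potential f s' - potential f (restrictTo Rᶜ s)) + δ := by
  have hres : restrictTo Rᶜ s' = restrictTo Rᶜ s :=
    restrictTo_congr fun u hu => hs u (by simpa using hu)
  set z : E → ℕ := fun e => load (restrictTo Rᶜ s) e with hz
  set A : E → Finset ι := fun e => R.filter fun u => e ∈ s u with hA
  set B : E → Finset ι := fun e => R.filter fun u => e ∈ s' u with hB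
  have hls : ∀ e, load s e = z e + (A e).card := fun e => load_eq_filter_add s R e
  have hls' : ∀ e, load s' e = z e + (B e).card := fun e => by
    rw [load_eq_filter_add s' R e, hres]
  have hcost : ∀ u, playerCost f' s u - playerCost f' (Function.update s u (s' u)) u =
      ∑ e, ((if e ∈ s u ∧ e ∉ s' u then f' e (load s e) else 0) -
        if e ∈ s' u ∧ e ∉ s u then f' e (load s e + 1) else 0) := by
    intro u
    have h1 : playerCost f' s u = ∑ e, if e ∈ s u then f' e (load s e) else 0 := by
      unfold playerCost
      rw [Finset.sum_ite_mem, Finset.univ_inter]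
    have h2 : playerCost f' (Function.update s u (s' u)) u =
        ∑ e, if e ∈ s' u then f' e (load (Function.update s u (s' u)) e) else 0 := by
      unfold playerCost
      rw [Finset.sum_ite_mem, Finset.univ_inter, Function.update_self]
    rw [h1, h2, ← Finset.sum_sub_distrib]
    refine Finset.sum_congr rfl fun e _ => ?_
    have l1 := load_eq_update_empty s u e
    have l2 := load_eq_update_empty (Function.update s u (s' u)) u e
    rw [Function.update_idem, Function.update_self] at l2
    by_cases ha : e ∈ s u <;> by_cases hb : e ∈ s' u <;> simp only [ha, hb, if_true, if_false,
      not_true, not_false_iff, and_true, and_false] at l1 l2 ⊢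
    · rw [l1, l2]; simp
    · have e1 : load (Function.update s u (s' u)) e = load s e + 1 := by omega
      rw [e1]
  have hsum : ∑ u ∈ R, (playerCost f' s u - playerCost f' (Function.update s u (s' u)) u) =
      ∑ e, (((A e \ B e).card : ℝ) * f' e (load s e) -
        ((B e \ A e).card : ℝ) * f' e (load s e + 1)) := by
    simp only [hcost]
    rw [Finset.sum_comm]
    refine Finset.sum_congr rfl fun e _ => ?_
    rw [Finset.sum_sub_distrib, ← Finset.sum_filter, ← Finset.sum_filter, Finset.sum_const,
      Finset.sum_const, nsmul_eq_mul, nsmul_eq_mul]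
    have e1 : (R.filter fun u => e ∈ s u ∧ e ∉ s' u) = A e \ B e := by
      ext u; simp only [hA, hB, Finset.mem_filter, Finset.mem_sdiff]; tauto
    have e2 : (R.filter fun u => e ∈ s' u ∧ e ∉ s u) = B e \ A e := by
      ext u; simp only [hA, hB, Finset.mem_filter, Finset.mem_sdiff]; tauto
    rw [e1, e2]
  have key : ∀ e, intervalSum (f e) 0 (load s e) - intervalSum (f e) 0 (z e) ≤
      ρ * (intervalSum (f e) 0 (load s' e) - intervalSum (f e) 0 (z e)) +
        (((A e \ B e).card : ℝ) * f' e (load s e) -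
          ((B e \ A e).card : ℝ) * f' e (load s e + 1)) := by
    intro e
    -- Players of `R` that use `e` in both states see the same load before and after deviating, so
    -- they are treated as frozen. Their part of the potential occurs with factor 1 on the left and
    -- `ρ ≥ 1` on the right.
    set k := (A e ∩ B e).card with hk
    have ha : (A e).card = k + (A e \ B e).card := by
      rw [hk, Finset.card_inter_add_card_sdiff]
    have hb : (B e).card = k + (B e \ A e).card := by
      rw [hk, Finset.inter_comm, Finset.card_inter_add_card_sdiff]
    have h1 := hsm e (z e + k) (A e \ B e).card (B e \ A e).card
    have h2 : (A e \ B e).card + (z e + k) = load s e := by rw [hls, ha]; omega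
    rw [h2] at h1
    have h3 : intervalSum (f e) 0 (load s e) = intervalSum (f e) 0 (z e) +
        intervalSum (f e) (z e) k + intervalSum (f e) (z e + k) (A e \ B e).card := by
      rw [hls, ha, ← add_assoc, intervalSum_add, intervalSum_add]; simp
    have h4 : intervalSum (f e) 0 (load s' e) = intervalSum (f e) 0 (z e) +
        intervalSum (f e) (z e) k + intervalSum (f e) (z e + k) (B e \ A e).card := by
      rw [hls', hb, ← add_assoc, intervalSum_add, intervalSum_add]; simp
    have h5 := intervalSum_nonneg (hf e) (z e) k
    rw [h3, h4]
    nlinarith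
  have := Finset.sum_le_sum fun e (_ : e ∈ Finset.univ) => key e
  rw [Finset.sum_add_distrib, ← hsum, ← Finset.mul_sum, Finset.sum_sub_distrib,
    Finset.sum_sub_distrib] at this
  unfold potential
  linarith

end Potential

/-! ### The potential of the movers along a run -/

section Runs

variable {ι E : Type} [Fintype ι] [DecidableEq ι] [Fintype E] [DecidableEq E]

/-- In each of the steps `t < T` of the sequence `x` of states at most player `u t` deviates. -/
def DeviationRun (x : ℕ → ι → Finset E) (u : ℕ → ι) (T : ℕ) : Prop :=
  ∀ t < T, ∃ S, x (t + 1) = Function.update (x t) (u t) S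

theorem DeviationRun.mono {x : ℕ → ι → Finset E} {u : ℕ → ι} {T T' : ℕ} (h : DeviationRun x u T)
    (hT : T' ≤ T) : DeviationRun x u T' := fun t ht => h t (by omega)

/-- The players that move in the first `T` steps. -/
def movers (u : ℕ → ι) (T : ℕ) : Finset ι := (Finset.range T).image u

theorem DeviationRun.eq_of_notMem {x : ℕ → ι → Finset E} {u : ℕ → ι} {T : ℕ}
    (h : DeviationRun x u T) {v : ι} (hv : v ∉ movers u T) : x T v = x 0 v := by
  induction T with
  | zero => rfl
  | succ T ih =>
    obtain ⟨S, hS⟩ := h T (by omega)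
    have h1 : v ∉ movers u T := fun hm => hv (by
      simp only [movers, Finset.mem_image, Finset.mem_range] at hm ⊢
      obtain ⟨t, ht, rfl⟩ := hm
      exact ⟨t, by omega, rfl⟩)
    have h2 : v ≠ u T := by
      rintro rfl
      exact hv (Finset.mem_image_of_mem u (Finset.mem_range.2 (by omega)))
    rw [hS, Function.update_of_ne h2, ih (h.mono (by omega)) h1]

theorem movers_succ (u : ℕ → ι) (T : ℕ) : movers u (T + 1) = insert (u T) (movers u T) := by
  rw [movers, Finset.range_add_one, Finset.image_insert]; rfl

/-- Effect of one deviation on the potentials of all sets of players. -/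
theorem potential_restrictTo_update {f : E → ℕ → ℝ} (hf : ∀ e, Monotone (f e))
    {s s' : ι → Finset E} {u : ι} {S : Finset E} (hs : s' = Function.update s u S)
    (R : Finset ι) (hu : u ∈ R) :
    potential f (restrictTo R s') ≤ potential f (restrictTo (R.erase u) s) + playerCost f s' u := by
  have h1 := potential_eq_update_empty f (restrictTo R s') u
  have h2 := playerCost_restrictTo_le hf hu s'
  rw [← restrictTo_erase] at h1
  have h3 : restrictTo (R.erase u) s' = restrictTo (R.erase u) s := by
    refine restrictTo_congr fun v hv => ?_
    rw [hs, Function.update_of_ne (Finset.ne_of_mem_erase hv)]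
  rw [h3] at h1
  linarith

theorem potential_restrictTo_update_of_notMem (f : E → ℕ → ℝ)
    {s s' : ι → Finset E} {u : ι} {S : Finset E} (hs : s' = Function.update s u S)
    (R : Finset ι) (hu : u ∉ R) :
    potential f (restrictTo R s') = potential f (restrictTo R s) := by
  congr 1
  refine restrictTo_congr fun v hv => ?_
  rw [hs, Function.update_of_ne (by rintro rfl; exact hu hv)]

open Classical in
/-- Total cost, before the move, of the moves in `A` whose cost lies in the window `(h, H]`. -/
noncomputable def windowCost (f : E → ℕ → ℝ) (x : ℕ → ι → Finset E) (u : ℕ → ι) (A : ℕ → Prop)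
    (h H : ℝ) (T : ℕ) : ℝ :=
  ∑ t ∈ Finset.range T, if A t ∧ h < playerCost f (x t) (u t) ∧ playerCost f (x t) (u t) ≤ H
    then playerCost f (x t) (u t) else 0

open Classical in
/-- Bookkeeping for a run with moves that improve the cost of the mover by the factor `p` and with
arbitrary moves to strategies of cost at most `h`. Every move of cost more than `H` pays for the
moves of cost at most `h` that follow it; moves with costs in between are charged to
`windowCost`. Here `v` is the potential after the last move of cost more than `H`, `b w` is the cost
of `w` after its last move since then, and `β w` is the cost of `w` after its last move of cost more
than `H`. -/
theorem exists_accounting {f : E → ℕ → ℝ} (hf : ∀ e, Monotone (f e)) (hf0 : ∀ e n, 0 ≤ f e n)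
    {p p' h H : ℝ} (hp' : 1 ≤ p') (hp : p' < p) (hh : 0 ≤ h) (hhH : h ≤ H)
    (hH : Fintype.card ι * h ≤ (1 - p' / p) * H)
    {x : ℕ → ι → Finset E} {u : ℕ → ι} {A : ℕ → Prop} {T : ℕ} (hx : DeviationRun x u T)
    (hA : ∀ t < T, A t → p * playerCost f (x (t + 1)) (u t) ≤ playerCost f (x t) (u t))
    (hA' : ∀ t < T, ¬ A t → playerCost f (x (t + 1)) (u t) ≤ h) :
    ∃ (v : ℝ) (b β : ι → ℝ), (∀ w, 0 ≤ b w) ∧ (∀ w, 0 ≤ β w) ∧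
      (∀ S : Finset ι, potential f (restrictTo S (x T)) ≤ v + ∑ w ∈ S, b w) ∧
      v + (p' - 1) * ∑ w, β w + ∑ w, max (b w - h) 0 ≤
        potential f (x 0) + windowCost f x u A h H T ∧
      ∀ S : Finset ι, potential f (restrictTo S (x T)) ≤
        potential f (restrictTo (S \ movers u T) (x 0)) + ∑ w ∈ S ∩ movers u T, (β w + H) := by
  have hf0' : ∀ e n, 0 < n → 0 ≤ f e n := fun e n _ => hf0 e n
  have hc0 : ∀ (s : ι → Finset E) (w : ι), 0 ≤ playerCost f s w := fun s w =>
    Finset.sum_nonneg fun e _ => hf0 e _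
  have hp0 : 0 < p := by linarith
  induction T with
  | zero =>
    refine ⟨potential f (x 0), 0, 0, fun _ => le_rfl, fun _ => le_rfl, fun S => ?_, ?_, fun S => ?_⟩
    · simpa using potential_mono hf0' (restrictTo_subset_self S (x 0))
    · simp [windowCost, hh]
    · simp [movers]
  | succ T ih =>
    obtain ⟨v, b, β, hb, hβ, h1, h2, h3⟩ := ih (hx.mono (by omega)) (fun t ht => hA t (by omega))
      (fun t ht => hA' t (by omega))
    obtain ⟨S₀, hS₀⟩ := hx T (by omega)
    set w₀ := u T with hw₀
    set a := playerCost f (x T) w₀ with ha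
    set c := playerCost f (x (T + 1)) w₀ with hc
    have hc' : 0 ≤ c := hc0 _ _
    have ha' : 0 ≤ a := hc0 _ _
    have hstep := potential_restrictTo_update hf hS₀
    have hstep' := potential_restrictTo_update_of_notMem f hS₀
    have hwin : windowCost f x u A h H (T + 1) = windowCost f x u A h H T +
        if A T ∧ h < a ∧ a ≤ H then a else 0 := by
      rw [windowCost, Finset.sum_range_succ]; rfl
    have hβupd : ∀ y : ℝ, 0 ≤ y → ∑ w, Function.update β w₀ y w ≤ ∑ w, β w + y := by
      intro y hy
      rw [Finset.sum_update_of_mem (Finset.mem_univ _)]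
      have := Finset.sum_le_sum_of_subset_of_nonneg (f := β)
        (Finset.subset_univ (Finset.univ \ {w₀})) fun w _ _ => hβ w
      linarith
    have hlast : ∀ β' : ι → ℝ, c ≤ β' w₀ + H → (∀ w, w ≠ w₀ → β' w = β w) →
        ∀ S : Finset ι, potential f (restrictTo S (x (T + 1))) ≤
        potential f (restrictTo (S \ movers u (T + 1)) (x 0)) +
          ∑ w ∈ S ∩ movers u (T + 1), (β' w + H) := by
      intro β' hβ₀ hβ' S
      rw [movers_succ]
      by_cases hS : w₀ ∈ S
      · have e1 := hstep S hS
        have e2 := h3 (S.erase w₀)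
        have e3 : S.erase w₀ \ movers u T = S \ insert (u T) (movers u T) := by
          ext w; simp only [Finset.mem_sdiff, Finset.mem_erase, Finset.mem_insert]; tauto
        have e4 : S ∩ insert (u T) (movers u T) = insert w₀ (S.erase w₀ ∩ movers u T) := by
          ext w
          simp only [Finset.mem_inter, Finset.mem_erase, Finset.mem_insert]
          by_cases hw : w = w₀
          · simp [hw, hS, ← hw₀]
          · simp [hw]
            intro _ h'; exact absurd h' hw
        have e5 : ∑ w ∈ S.erase w₀ ∩ movers u T, (β w + H) =
            ∑ w ∈ S.erase w₀ ∩ movers u T, (β' w + H) :=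
          Finset.sum_congr rfl fun w hw => by
            rw [hβ' w (Finset.ne_of_mem_erase (Finset.mem_inter.1 hw).1)]
        rw [e4, Finset.sum_insert (by simp), ← e3, ← e5]
        linarith
      · rw [hstep' S hS]
        have e3 : S \ insert (u T) (movers u T) = S \ movers u T := by
          ext w
          simp only [Finset.mem_sdiff, Finset.mem_insert, not_or]
          have : w ∈ S → w ≠ u T := fun hw h' => hS (by rw [hw₀, ← h']; exact hw)
          tauto
        have e4 : S ∩ insert (u T) (movers u T) = S ∩ movers u T :=
          Finset.inter_insert_of_notMem hS
        rw [e3, e4]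
        refine (h3 S).trans (le_of_eq ?_)
        congr 1
        exact Finset.sum_congr rfl fun w hw => by
          rw [hβ' w (by rintro rfl; exact hS (Finset.mem_inter.1 hw).1)]
    by_cases hbig : A T ∧ H < a
    · have hpc := hA T (by omega) hbig.1
      -- An expensive move closes the account: the open entries `b` are absorbed into `v`. The left
      -- side of the second invariant grows by at most `N h + p' c - a`, where `N` is the number of
      -- players, and this is at most `N h - (1 - p' / p) H ≤ 0`.
      refine ⟨potential f (x (T + 1)), 0, Function.update β w₀ c, fun _ => le_rfl, ?_, fun S => ?_,
        ?_, hlast _ (by simp; linarith) fun w hw => by simp [hw]⟩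
      · intro w
        by_cases hw : w = w₀
        · subst hw; simpa using hc'
        · simpa [hw] using hβ w
      · simpa using potential_mono hf0' (restrictTo_subset_self S (x (T + 1)))
      · rw [hwin, if_neg (by rintro ⟨_, _, h'⟩; linarith [hbig.2])]
        have e1 : potential f (x (T + 1)) - potential f (x T) = c - a := by
          have := potential_update_sub f (x T) w₀ S₀
          rw [← hS₀] at this
          exact this
        have e2 := h1 Finset.univ
        rw [restrictTo_univ] at e2
        have e3 : ∑ w, b w ≤ Fintype.card ι * h + ∑ w, max (b w - h) 0 := by
          have : ∑ w : ι, b w ≤ ∑ w : ι, (h + max (b w - h) 0) :=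
            Finset.sum_le_sum fun w _ => by linarith [le_max_left (b w - h) 0]
          rw [Finset.sum_add_distrib] at this
          simpa using this
        have e4 := hβupd c hc'
        have e5 : p' * c ≤ p' / p * a := by
          rw [div_mul_eq_mul_div, le_div_iff₀ hp0]
          nlinarith
        have e6 : (1 - p' / p) * H ≤ (1 - p' / p) * a := by
          have : 0 ≤ 1 - p' / p := by
            rw [sub_nonneg, div_le_one hp0]; exact hp.le
          nlinarith [hbig.2]
        have e7 : (p' - 1) * ∑ w, Function.update β w₀ c w ≤ (p' - 1) * (∑ w, β w + c) :=
          mul_le_mul_of_nonneg_left e4 (by linarith)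
        simp only [Pi.zero_apply, zero_sub, Finset.sum_const]
        rw [max_eq_right (by linarith), smul_zero]
        linarith
    · have hcH : c ≤ H := by
        by_cases hAT : A T
        · have := hA T (by omega) hAT
          have h5 : a ≤ H := not_lt.1 fun h' => hbig ⟨hAT, h'⟩
          nlinarith
        · exact (hA' T (by omega) hAT).trans hhH
      -- For every other move only `b w₀` changes. The excess of `c` over `h` is zero unless the
      -- move lies in the window, where its cost is charged; and `c ≤ H` keeps the last invariant
      -- with the old `β`.
      refine ⟨v, Function.update b w₀ c, β, ?_, hβ, fun S => ?_, ?_,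
        hlast β (by linarith [hβ w₀]) fun _ _ => rfl⟩
      · intro w
        by_cases hw : w = w₀
        · subst hw; simpa using hc'
        · simpa [hw] using hb w
      · by_cases hS : w₀ ∈ S
        · have e1 := hstep S hS
          have e2 := h1 (S.erase w₀)
          rw [Finset.sum_update_of_mem hS, Finset.sdiff_singleton_eq_erase]
          linarith
        · rw [hstep' S hS, Finset.sum_update_of_notMem hS]
          exact h1 S
      · have e1 : ∑ w, max (Function.update b w₀ c w - h) 0 ≤
            ∑ w, max (b w - h) 0 + max (c - h) 0 := by
          rw [← Finset.add_sum_erase _ _ (Finset.mem_univ w₀), ← Finset.add_sum_erase _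
            (fun w => max (b w - h) 0) (Finset.mem_univ w₀)]
          have : ∑ w ∈ Finset.univ.erase w₀, max (Function.update b w₀ c w - h) 0 =
              ∑ w ∈ Finset.univ.erase w₀, max (b w - h) 0 :=
            Finset.sum_congr rfl fun w hw => by
              rw [Function.update_of_ne (Finset.ne_of_mem_erase hw)]
          rw [this, Function.update_self]
          linarith [le_max_right (b w₀ - h) 0]
        have e2 : max (c - h) 0 ≤ if A T ∧ h < a ∧ a ≤ H then a else 0 := by
          by_cases hAT : A T
          · have hpc := hA T (by omega) hAT
            have h5 : a ≤ H := not_lt.1 fun h' => hbig ⟨hAT, h'⟩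
            have hca : c ≤ a := by nlinarith
            split_ifs with hw
            · exact max_le (by linarith) ha'
            · have : a ≤ h := not_lt.1 fun h' => hw ⟨hAT, h', h5⟩
              exact max_le (by linarith) le_rfl
          · rw [if_neg fun h' => hAT h'.1]
            exact max_le (by linarith [hA' T (by omega) hAT]) le_rfl
        rw [hwin]
        linarith

/-- The potential of the movers falls essentially by the factor `p'`. -/
theorem mul_potential_movers_le {f : E → ℕ → ℝ} (hf : ∀ e, Monotone (f e)) (hf0 : ∀ e n, 0 ≤ f e n)
    {p p' h H : ℝ} (hp' : 1 ≤ p') (hp : p' < p) (hh : 0 ≤ h) (hhH : h ≤ H)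
    (hH : Fintype.card ι * h ≤ (1 - p' / p) * H)
    {x : ℕ → ι → Finset E} {u : ℕ → ι} {A : ℕ → Prop} {T : ℕ} (hx : DeviationRun x u T)
    (hA : ∀ t < T, A t → p * playerCost f (x (t + 1)) (u t) ≤ playerCost f (x t) (u t))
    (hA' : ∀ t < T, ¬ A t → playerCost f (x (t + 1)) (u t) ≤ h) :
    p' * (potential f (x T) - potential f (restrictTo (movers u T)ᶜ (x 0))) ≤
      potential f (x 0) - potential f (restrictTo (movers u T)ᶜ (x 0)) +
        windowCost f x u A h H T + p' * (Fintype.card ι * H) := by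
  obtain ⟨v, b, β, hb, hβ, h1, h2, h3⟩ := exists_accounting hf hf0 hp' hp hh hhH hH hx hA hA'
  have e1 := h1 Finset.univ
  have e2 := h3 Finset.univ
  rw [restrictTo_univ] at e1 e2
  rw [← Finset.compl_eq_univ_sdiff, Finset.univ_inter] at e2
  have e3 : ∑ w, b w ≤ Fintype.card ι * h + ∑ w, max (b w - h) 0 := by
    have : ∑ w : ι, b w ≤ ∑ w : ι, (h + max (b w - h) 0) :=
      Finset.sum_le_sum fun w _ => by linarith [le_max_left (b w - h) 0]
    rw [Finset.sum_add_distrib] at this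
    simpa using this
  have hH0 : 0 ≤ H := hh.trans hhH
  have e4 : ∑ w ∈ movers u T, (β w + H) ≤ ∑ w, β w + Fintype.card ι * H := by
    have : ∑ w ∈ movers u T, (β w + H) ≤ ∑ w : ι, (β w + H) :=
      Finset.sum_le_sum_of_subset_of_nonneg (Finset.subset_univ _) fun w _ _ => by
        linarith [hβ w]
    refine this.trans (le_of_eq ?_)
    rw [Finset.sum_add_distrib]
    simp
  have e5 : (Fintype.card ι : ℝ) * h ≤ Fintype.card ι * H := by gcongr
  -- Adding `p' - 1` times the bound by `β` to the bound by `v` and `b` produces precisely the left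
  -- side of the second invariant.
  have e6 := mul_le_mul_of_nonneg_left (e2.trans (add_le_add_right e4 _))
    (by linarith : 0 ≤ p' - 1)
  linarith

end Runs

/-! ### The cost of the movers in one phase -/

section Phase

variable {ι E : Type} [Fintype ι] [DecidableEq ι] [Fintype E] [DecidableEq E]

open Classical in
-- Consecutive windows are disjoint, so a given cost is counted at most once.
theorem sum_window_eq {h : ℕ → ℝ} (hh : Monotone h) (Q : Prop) (a : ℝ) (m : ℕ) :
    ∑ k ∈ Finset.range m, (if Q ∧ h k < a ∧ a ≤ h (k + 1) then a else 0) =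
      if Q ∧ h 0 < a ∧ a ≤ h m then a else 0 := by
  induction m with
  | zero => simp
  | succ m ih =>
    rw [Finset.sum_range_succ, ih]
    have h1 : h 0 ≤ h m := hh (Nat.zero_le m)
    have h2 : h m ≤ h (m + 1) := hh (Nat.le_succ m)
    by_cases hQ : Q
    · by_cases h3 : a ≤ h m
      · rw [if_neg (fun h' : Q ∧ h m < a ∧ a ≤ h (m + 1) => absurd h'.2.1 (not_lt.2 h3)), add_zero]
        simp [hQ, h3, h3.trans h2]
      · rw [if_neg (fun h' : Q ∧ h 0 < a ∧ a ≤ h m => h3 h'.2.2), zero_add]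
        rw [not_le] at h3
        simp [hQ, h3, lt_of_le_of_lt h1 h3]
    · simp [hQ]

open Classical in
/-- With respect to `f'`, no step of the run increases the cost of its mover, so the steps that
improve the cost with respect to `f` by a factor `p > ρ` have bounded total cost. -/
theorem sum_windowCost_le {f f' : E → ℕ → ℝ} (hf0 : ∀ e n, 0 ≤ f e n) {ρ p : ℝ} (hρ : 0 < ρ)
    (hp : ρ < p) (hff' : ∀ e n, 0 < n → f e n ≤ f' e n)
    (hf'f : ∀ e n, 0 < n → f' e n ≤ ρ * f e n) {h : ℕ → ℝ} (hh : Monotone h)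
    {x : ℕ → ι → Finset E} {u : ℕ → ι} {A : ℕ → Prop} {T : ℕ} (hx : DeviationRun x u T)
    (hA : ∀ t < T, A t → p * playerCost f (x (t + 1)) (u t) ≤ playerCost f (x t) (u t))
    (hA' : ∀ t < T, ¬ A t → playerCost f' (x (t + 1)) (u t) ≤ playerCost f' (x t) (u t)) (m : ℕ) :
    (∑ k ∈ Finset.range m, windowCost f x u A (h k) (h (k + 1)) T) * (1 - ρ / p) ≤
      potential f' (x 0) - potential f' (x T) := by
  have hp0 : 0 < p := hρ.trans hp
  unfold windowCost
  rw [Finset.sum_comm]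
  simp only [sum_window_eq hh]
  induction T with
  | zero => simp
  | succ T ih =>
    have ih := ih (hx.mono (by omega)) (fun t ht => hA t (by omega)) (fun t ht => hA' t (by omega))
    rw [Finset.sum_range_succ, add_mul]
    obtain ⟨S₀, hS₀⟩ := hx T (by omega)
    have e1 := potential_update_sub f' (x T) (u T) S₀
    rw [← hS₀] at e1
    have hθ : 0 ≤ 1 - ρ / p := by rw [sub_nonneg, div_le_one hp0]; exact hp.le
    have hc0 : 0 ≤ playerCost f (x T) (u T) := Finset.sum_nonneg fun e _ => hf0 e _
    -- Because `f ≤ f' ≤ ρ f`, a `p`-move for `f` lowers the cost for `f'` at least to the fraction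
    -- `ρ / p`.
    have e2 : (if A T ∧ h 0 < playerCost f (x T) (u T) ∧ playerCost f (x T) (u T) ≤ h m then
        playerCost f (x T) (u T) else 0) * (1 - ρ / p) ≤
        playerCost f' (x T) (u T) - playerCost f' (x (T + 1)) (u T) := by
      by_cases hAT : A T
      · have h1 := hA T (by omega) hAT
        have h2 := playerCost_le_mul hf'f (x (T + 1)) (u T)
        have h3 : playerCost f (x T) (u T) ≤ playerCost f' (x T) (u T) :=
          Finset.sum_le_sum fun e he => hff' e _ (load_pos he)
        have h4 : ρ * playerCost f (x (T + 1)) (u T) ≤ ρ / p * playerCost f (x T) (u T) := by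
          rw [div_mul_eq_mul_div, le_div_iff₀ hp0]
          nlinarith
        have h5 : playerCost f (x T) (u T) * (1 - ρ / p) ≤
            playerCost f' (x T) (u T) - playerCost f' (x (T + 1)) (u T) := by linarith
        split_ifs
        · exact h5
        · rw [zero_mul]; nlinarith
      · rw [if_neg fun h' => hAT h'.1, zero_mul, sub_nonneg]
        exact hA' T (by omega) hAT
    linarith

/-- If a potential falls from `X` to at most `Y / ρ` by smoothness and to at least `p' Y` by the
moves, up to errors of order `Q`, then it is of order `Q`. -/
theorem le_of_smooth_of_decrease {ρ p' δ θ Q X Y : ℝ} (hρ : 1 ≤ ρ) (hp' : 0 < p') (hδ : 0 < δ)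
    (hθ : 0 ≤ θ) (hδ' : 1 + 2 * δ ≤ (1 - θ) * (p' / ρ)) (hQ : 0 ≤ Q) (hX : 0 ≤ X)
    (hY : p' * Y ≤ (1 + δ) * (X + Q) + p' * Q) (hXY : X * (1 - θ) ≤ ρ * (Y + Q)) :
    X ≤ ((1 + δ + 2 * p') / δ + 2) * Q ∧ Y ≤ ((1 + δ + 2 * p') / δ + 2) * Q := by
  have hρ0 : 0 < ρ := by linarith
  have h1 : X * (1 + 2 * δ) ≤ p' * (Y + Q) := by
    calc X * (1 + 2 * δ) ≤ X * ((1 - θ) * (p' / ρ)) := by gcongr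
      _ = X * (1 - θ) * (p' / ρ) := by ring
      _ ≤ ρ * (Y + Q) * (p' / ρ) := by gcongr
      _ = p' * (Y + Q) := by field_simp
  have hXQ : X ≤ (1 + δ + 2 * p') / δ * Q := by
    rw [div_mul_eq_mul_div, le_div_iff₀ hδ]; linarith
  have h2 : 1 + δ ≤ p' := by
    have h3 : p' / ρ ≤ p' := div_le_self hp'.le hρ
    have h5 : 0 < p' / ρ := by positivity
    nlinarith
  have h3 : Y ≤ X + 2 * Q := by
    have h4 : (1 + δ) * (X + Q) ≤ p' * (X + Q) := by gcongr
    have h5 : p' * Y ≤ p' * (X + 2 * Q) := by linarith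
    exact le_of_mul_le_mul_left h5 hp'
  constructor <;> linarith

set_option maxHeartbeats 800000 in
/-- Main estimate for a phase. The players in `B` start in an approximate equilibrium for the
modified costs `f'` and make `p`-moves for the costs `f`, the players in `C` have small costs and
make improving moves for `f'`. Then the players in `B` that move have small costs, too. -/
theorem movers_cost_le {f f' : E → ℕ → ℝ} (hf : ∀ e, Monotone (f e)) (hf0 : ∀ e n, 0 ≤ f e n)
    {ρ p p' τ D δ h₀ L : ℝ} {m : ℕ} (hρ : 1 ≤ ρ) (hρp' : ρ < p') (hp : p' < p)
    (hsm : ∀ e, StronglySmooth ρ (f e) (f' e))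
    (hD : ∀ e, f e (Fintype.card ι) ≤ D * f e 1) (hD0 : 0 ≤ D) (hτ : 0 ≤ τ) (hδ : 0 < δ)
    (hm : ρ / (1 - ρ / p) ≤ δ * m) (hδ' : 1 + 2 * δ ≤ (1 - τ * ρ * D) * (p' / ρ))
    (hL : 1 ≤ L) (hLN : Fintype.card ι ≤ (1 - p' / p) * L) (hh₀ : 0 ≤ h₀)
    {x : ℕ → ι → Finset E} {u : ℕ → ι} {A : ℕ → Prop} {T : ℕ} (hx : DeviationRun x u T)
    (B C : Finset ι) (hAB : ∀ t < T, A t → u t ∈ B) (hAC : ∀ t < T, ¬ A t → u t ∈ C)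
    (hA : ∀ t < T, A t → p * playerCost f (x (t + 1)) (u t) ≤ playerCost f (x t) (u t))
    (hA' : ∀ t < T, ¬ A t → playerCost f' (x (t + 1)) (u t) ≤ playerCost f' (x t) (u t))
    (hC : ∀ t ≤ T, ∀ w ∈ C, ∑ e ∈ x t w, f e (Fintype.card ι) ≤ h₀)
    (heq : ∀ w ∈ B, playerCost f' (x 0) w - playerCost f' (Function.update (x 0) w (x T w)) w ≤
      τ * playerCost f' (x 0) w) :
    ∑ w ∈ movers u T ∩ B, ∑ e ∈ x 0 w, f e 1 ≤
        ((1 + δ + 2 * p') / δ + 2) * (Fintype.card ι * (h₀ * L ^ m)) ∧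
      ∑ w ∈ movers u T ∩ B, ∑ e ∈ x T w, f e 1 ≤
        ((1 + δ + 2 * p') / δ + 2) * (Fintype.card ι * (h₀ * L ^ m)) := by
  have hf0' : ∀ e n, 0 < n → 0 ≤ f e n := fun e n _ => hf0 e n
  have hff' : ∀ e n, 0 < n → f e n ≤ f' e n := fun e n hn => (hsm e).le hn
  have hf'f : ∀ e n, 0 < n → f' e n ≤ ρ * f e n := fun e n hn => (hsm e).le_mul hn
  have hf'0 : ∀ e n, 0 < n → 0 ≤ f' e n := fun e n hn => (hf0 e n).trans (hff' e n hn)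
  have hp0 : 0 < p := by linarith
  have hp'0 : 0 < p' := by linarith
  have hρ0 : 0 < ρ := by linarith
  set N : ℝ := (Fintype.card ι : ℝ) with hN
  have hN0 : 0 ≤ N := Nat.cast_nonneg _
  set M := movers u T with hM
  -- `R` carries the argument; the other movers `W` lie in `C` and contribute at most `N * h₀` in
  -- either direction.
  set R := M ∩ B with hR
  set W := M \ B with hW
  set Z := potential f (restrictTo Mᶜ (x 0)) with hZ
  set X := potential f (x 0) - potential f (restrictTo Rᶜ (x 0)) with hX
  set Y₀ := potential f (x 0) - Z with hY₀
  set Y₁ := potential f (x T) - Z with hY₁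
  have hxT : ∀ v ∈ Mᶜ, x T v = x 0 v := fun v hv => hx.eq_of_notMem (by simpa using hv)
  have hWC : ∀ w ∈ W, w ∈ C := by
    intro w hw
    rw [hW, Finset.mem_sdiff] at hw
    obtain ⟨t, ht, rfl⟩ := Finset.mem_image.1 hw.1
    rw [Finset.mem_range] at ht
    by_cases hAt : A t
    · exact absurd (hAB t ht hAt) hw.2
    · exact hAC t ht hAt
  have hWsum : ∀ s : ι → Finset E, (∀ w ∈ W, s w = x 0 w) → ∑ w ∈ W, playerCost f s w ≤ N * h₀ := by
    intro s hs
    have : ∑ w ∈ W, playerCost f s w ≤ ∑ w ∈ W, h₀ := Finset.sum_le_sum fun w hw =>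
      (playerCost_le_sum_card hf s w).trans (by rw [hs w hw]; exact hC 0 (by omega) w (hWC w hw))
    rw [Finset.sum_const, nsmul_eq_mul] at this
    have h2 : (W.card : ℝ) ≤ N := by
      rw [hN]; exact_mod_cast Finset.card_le_univ W
    exact this.trans (by gcongr)
  have hRW : Rᶜ \ W = Mᶜ := by
    ext v; simp only [hR, hW, Finset.mem_sdiff, Finset.mem_compl, Finset.mem_inter]; tauto
  have hWR : W ⊆ Rᶜ := by
    intro v; simp only [hR, hW, Finset.mem_sdiff, Finset.mem_compl, Finset.mem_inter]; tauto
  have hMR : Mᶜ ⊆ Rᶜ := by rw [← hRW]; exact Finset.sdiff_subset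
  have hZR : Z ≤ potential f (restrictTo Rᶜ (x 0)) :=
    potential_mono hf0' (restrictTo_subset hMR (x 0))
  have hY₀X : Y₀ ≤ X + N * h₀ := by
    have h1 := potential_le_sdiff_add hf (x 0) Rᶜ W hWR
    rw [hRW] at h1
    have h2 := hWsum (x 0) fun _ _ => rfl
    linarith
  -- A hybrid state: only the movers of `B` adopt their final strategies. Smoothness compares `x 0`
  -- with it, since the equilibrium hypothesis concerns just these players.
  set s' : ι → Finset E := fun v => if v ∈ R then x T v else x 0 v with hs'
  have hs'Y : potential f s' - potential f (restrictTo Rᶜ (x 0)) ≤ Y₁ + N * h₀ := by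
    have h1 := potential_le_sdiff_add hf s' Finset.univ W (Finset.subset_univ W)
    rw [restrictTo_univ] at h1
    have h2 := hWsum s' fun w hw => by
      have : w ∉ R := by simpa using hWR hw
      simp [hs', this]
    have h3 : restrictTo (Finset.univ \ W) s' = restrictTo (Finset.univ \ W) (x T) := by
      refine restrictTo_congr fun v hv => ?_
      by_cases hvR : v ∈ R
      · simp [hs', hvR]
      · have : v ∈ Mᶜ := by
          rw [← hRW]
          simp only [Finset.mem_sdiff, Finset.mem_univ, true_and, Finset.mem_compl] at hv ⊢
          exact ⟨hvR, hv⟩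
        simp [hs', hvR, hxT v this]
    rw [h3] at h1
    have h4 := potential_mono hf0' (restrictTo_subset_self (Finset.univ \ W) (x T))
    linarith
  have hXR : ∑ w ∈ R, ∑ e ∈ x 0 w, f e 1 ≤ X := by
    have := potential_sdiff_add_le hf (x 0) Finset.univ R (Finset.subset_univ R)
    rw [restrictTo_univ, ← Finset.compl_eq_univ_sdiff] at this
    linarith
  -- The equilibrium error is `τ` times this sum, hence a small multiple of `X` that the left side
  -- of the smoothness bound absorbs.
  have hcost : ∑ w ∈ R, playerCost f' (x 0) w ≤ ρ * D * X := by
    have h1 : ∀ w ∈ R, playerCost f' (x 0) w ≤ ρ * D * ∑ e ∈ x 0 w, f e 1 := by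
      intro w _
      have h2 := playerCost_le_mul hf'f (x 0) w
      have h3 := playerCost_le_sum_card hf (x 0) w
      have h4 : ∑ e ∈ x 0 w, f e (Fintype.card ι) ≤ D * ∑ e ∈ x 0 w, f e 1 := by
        rw [Finset.mul_sum]; exact Finset.sum_le_sum fun e _ => hD e
      calc _ ≤ _ := h2
        _ ≤ ρ * (D * ∑ e ∈ x 0 w, f e 1) := by gcongr; exact h3.trans h4
        _ = _ := by ring
    refine (Finset.sum_le_sum h1).trans ?_
    rw [← Finset.mul_sum]
    gcongr
  have hX1 : X * (1 - τ * ρ * D) ≤ ρ * (Y₁ + N * h₀) := by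
    have h1 := potential_le_of_stronglySmooth (δ := τ * (ρ * D * X)) hρ hf0' hsm (x 0) s' R
      (fun v hv => by simp [hs', hv]) (by
        have : ∀ w ∈ R, playerCost f' (x 0) w - playerCost f' (Function.update (x 0) w (s' w)) w ≤
            τ * playerCost f' (x 0) w := fun w hw => by
          have e : s' w = x T w := by simp [hs', hw]
          rw [e]
          exact heq w (Finset.mem_inter.1 hw).2
        refine (Finset.sum_le_sum this).trans ?_
        rw [← Finset.mul_sum]
        gcongr)
    have h2 := mul_le_mul_of_nonneg_left hs'Y hρ0.le
    linarith
  have hL0 : 0 < L := by linarith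
  have hmono : Monotone fun k : ℕ => h₀ * L ^ k := fun i j hij => by
    dsimp only
    gcongr
  have hθ : 0 < 1 - ρ / p := by rw [sub_pos, div_lt_one hp0]; linarith
  have hY₀0 : 0 ≤ Y₀ := by
    have := potential_mono hf0' (restrictTo_subset_self Mᶜ (x 0))
    linarith
  have htot : (∑ k ∈ Finset.range m,
      windowCost f x u A (h₀ * L ^ k) (h₀ * L ^ (k + 1)) T) ≤ δ * m * Y₀ := by
    have h1 := sum_windowCost_le hf0 hρ0 (by linarith) hff' hf'f hmono hx hA hA' m
    have h2 : potential f' (restrictTo Mᶜ (x 0)) ≤ potential f' (x T) := by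
      rw [← restrictTo_congr hxT]
      exact potential_mono hf'0 (restrictTo_subset_self Mᶜ (x T))
    have h3 := potential_sub_le_mul hf'f (restrictTo_subset_self Mᶜ (x 0))
    rw [← le_div_iff₀ hθ] at h1
    have h4 : (potential f' (x 0) - potential f' (x T)) / (1 - ρ / p) ≤ ρ * Y₀ / (1 - ρ / p) := by
      gcongr; linarith
    have h5 : ρ * Y₀ / (1 - ρ / p) ≤ δ * m * Y₀ := by
      rw [mul_div_right_comm]; exact mul_le_mul_of_nonneg_right hm hY₀0
    exact h1.trans (h4.trans h5)
  have hm0 : 0 < m := by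
    rcases Nat.eq_zero_or_pos m with rfl | h
    · have : 0 < ρ / (1 - ρ / p) := by positivity
      simp at hm; linarith
    · exact h
  -- Pigeonhole: the `m` windows together cost at most `δ * m * Y₀`.
  obtain ⟨k, hk, hkE⟩ : ∃ k ∈ Finset.range m,
      windowCost f x u A (h₀ * L ^ k) (h₀ * L ^ (k + 1)) T ≤ δ * Y₀ := by
    refine Finset.exists_le_of_sum_le ⟨0, Finset.mem_range.2 hm0⟩ ?_
    rw [Finset.sum_const, Finset.card_range, nsmul_eq_mul]
    linarith
  rw [Finset.mem_range] at hk
  have hκ : 0 < 1 - p' / p := by rw [sub_pos, div_lt_one hp0]; exact hp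
  have hkey := mul_potential_movers_le hf hf0 (p := p) (p' := p') (h := h₀ * L ^ k)
    (H := h₀ * L ^ (k + 1)) (by linarith) hp (by positivity) (hmono (Nat.le_succ k))
    (by
      have := mul_le_mul_of_nonneg_right hLN (by positivity : 0 ≤ h₀ * L ^ k)
      rw [pow_succ]; linarith) hx hA
    (fun t ht hAt => by
      refine (playerCost_le_sum_card hf _ _).trans
        ((hC (t + 1) (by omega) _ (hAC t ht hAt)).trans ?_)
      exact le_mul_of_one_le_right hh₀ (one_le_pow₀ hL))
  have hHm : h₀ * L ^ (k + 1) ≤ h₀ * L ^ m := hmono hk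
  have hhm : h₀ ≤ h₀ * L ^ m := le_mul_of_one_le_right hh₀ (one_le_pow₀ hL)
  set Q := N * (h₀ * L ^ m) with hQ
  have hQ1 : N * (h₀ * L ^ (k + 1)) ≤ Q := mul_le_mul_of_nonneg_left hHm hN0
  have hQ2 : N * h₀ ≤ Q := mul_le_mul_of_nonneg_left hhm hN0
  have hQ0 : 0 ≤ Q := by positivity
  have hX0 : 0 ≤ X := by
    have := potential_mono hf0' (restrictTo_subset_self Rᶜ (x 0))
    linarith
  have hY₁le : p' * Y₁ ≤ (1 + δ) * (X + Q) + p' * Q := by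
    have h1 : (1 + δ) * Y₀ ≤ (1 + δ) * (X + Q) := by gcongr; linarith
    have h2 := mul_le_mul_of_nonneg_left hQ1 hp'0.le
    linarith
  have hXQ : X * (1 - τ * ρ * D) ≤ ρ * (Y₁ + Q) :=
    hX1.trans (mul_le_mul_of_nonneg_left (by linarith) hρ0.le)
  obtain ⟨hXle, hYle⟩ := le_of_smooth_of_decrease hρ hp'0 hδ (by positivity) hδ' hQ0 hX0 hY₁le hXQ
  have h1 : ∑ w ∈ R, ∑ e ∈ x T w, f e 1 ≤ Y₁ := by
    have h1 := potential_sdiff_add_le hf (x T) Finset.univ R (Finset.subset_univ R)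
    rw [restrictTo_univ, ← Finset.compl_eq_univ_sdiff] at h1
    have h2 := potential_mono hf0' (restrictTo_subset hMR (x T))
    rw [restrictTo_congr hxT] at h2
    linarith
  exact ⟨hXR.trans hXle, h1.trans hYle⟩

end Phase

/-! ### Blocks, phases and the number of steps -/

namespace CongestionGame

variable {ι E : Type} [Fintype ι] [DecidableEq ι] [Fintype E] [DecidableEq E]

theorem aloneCost_nonneg (G : CongestionGame ι E) (t : Finset E) : 0 ≤ G.aloneCost t :=
  Finset.sum_nonneg fun e _ => G.cost_nonneg e 1

theorem ell_le (G : CongestionGame ι E) {u : ι} {t : Finset E} (ht : t ∈ G.strategies u) :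
    G.ell u ≤ G.aloneCost t := Finset.inf'_le _ ht

theorem exists_aloneCost_eq_ell (G : CongestionGame ι E) (u : ι) :
    ∃ t ∈ G.strategies u, G.aloneCost t = G.ell u := by
  obtain ⟨t, ht, h⟩ := Finset.exists_mem_eq_inf' (G.strategies_nonempty u) G.aloneCost
  exact ⟨t, ht, h.symm⟩

theorem ell_nonneg (G : CongestionGame ι E) (u : ι) : 0 ≤ G.ell u := by
  obtain ⟨t, _, ht⟩ := G.exists_aloneCost_eq_ell u
  exact ht ▸ G.aloneCost_nonneg t

theorem ell_le_ellMax (G : CongestionGame ι E) (u : ι) : G.ell u ≤ G.ellMax :=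
  le_ciSup (Set.finite_range _).bddAbove u

theorem Delta_nonneg (G : CongestionGame ι E) : 0 ≤ G.Delta :=
  Real.iSup_nonneg fun e => div_nonneg (G.cost_nonneg e _) (G.cost_nonneg e 1)

theorem blockRatio_nonneg (G : CongestionGame ι E) (c : ℕ) : 0 ≤ G.blockRatio c := by
  have := G.Delta_nonneg
  unfold blockRatio
  positivity

theorem ellMax_nonneg (G : CongestionGame ι E) : 0 ≤ G.ellMax :=
  Real.iSup_nonneg fun u => G.ell_nonneg u

theorem InBlock.ell_pos {G : CongestionGame ι E} {c i : ℕ} {u : ι} (h : G.InBlock c i u) :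
    0 < G.ell u :=
  lt_of_le_of_lt (div_nonneg G.ellMax_nonneg (pow_nonneg (G.blockRatio_nonneg c) _)) h.1

theorem exists_isBestResponse (G : CongestionGame ι E) (f : E → ℕ → ℝ) (s : ι → Finset E) (u : ι) :
    ∃ t, G.IsBestResponse f s u t := by
  obtain ⟨t, ht, h⟩ := (G.strategies u).exists_min_image
    (fun t => playerCost f (Function.update s u t) u) (G.strategies_nonempty u)
  exact ⟨t, ht, h⟩

theorem IsBestResponse.lt_of_hasMove {G : CongestionGame ι E} {f : E → ℕ → ℝ} {α : ℝ}
    {s : ι → Finset E} {u : ι} {t : Finset E} (h : G.IsBestResponse f s u t)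
    (hm : G.HasMove f α s u) : playerCost f (Function.update s u t) u < playerCost f s u / α := by
  obtain ⟨t', ht', hlt⟩ := hm
  exact (h.2 t' ht').trans_lt hlt

section Run

variable {G : CongestionGame ι E} {f' : E → ℕ → ℝ} {ρ p : ℝ} {c k : ℕ}
  {x : ℕ → ℕ × (ι → Finset E)}

/-- Up to time `k`, phase `j` ends at time `T`. -/
def IsPhaseEnd (G : CongestionGame ι E) (f' : E → ℕ → ℝ) (p : ℝ) (c k : ℕ)
    (x : ℕ → ℕ × (ι → Finset E)) (j T : ℕ) : Prop :=
  T ≤ k ∧ (x T).1 = j ∧ (∀ t, T < t → t ≤ k → j < (x t).1) ∧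
    (T < k → (x (T + 1)).2 = (x T).2 ∧ ∀ u S, ¬ G.AllowedMove f' p c j (x T).2 u S)

/-- A run of the algorithm on a game with players of positive cost. -/
structure GoodRun (G : CongestionGame ι E) (f' : E → ℕ → ℝ) (ρ p : ℝ) (c k : ℕ)
    (x : ℕ → ℕ × (ι → Finset E)) : Prop where
  run : G.IsRun f' p c k x
  smooth : ∀ e, StronglySmooth ρ (G.cost e) (f' e)
  one_lt : 1 < ρ
  lt_p : ρ < p
  one_le_Delta : 1 ≤ G.Delta
  cost_card_le : ∀ e, G.cost e (Fintype.card ι) ≤ G.Delta * G.cost e 1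
  exists_pos : ∃ u, 0 < G.ell u

namespace GoodRun

theorem sum_card_le (h : GoodRun G f' ρ p c k x) (t : Finset E) :
    ∑ e ∈ t, G.cost e (Fintype.card ι) ≤ G.Delta * G.aloneCost t := by
  unfold aloneCost
  rw [Finset.mul_sum]
  exact Finset.sum_le_sum fun e _ => h.cost_card_le e

theorem le_modified (h : GoodRun G f' ρ p c k x) (e : E) (n : ℕ) (hn : 0 < n) :
    G.cost e n ≤ f' e n := (h.smooth e).le hn

theorem modified_le (h : GoodRun G f' ρ p c k x) (e : E) (n : ℕ) (hn : 0 < n) :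
    f' e n ≤ ρ * G.cost e n := (h.smooth e).le_mul hn

theorem playerCost_le_modified (h : GoodRun G f' ρ p c k x) (s : ι → Finset E) (u : ι) :
    playerCost G.cost s u ≤ playerCost f' s u :=
  Finset.sum_le_sum fun e he => h.le_modified e _ (load_pos he)

theorem playerCost_nonneg (s : ι → Finset E) (u : ι) : 0 ≤ playerCost G.cost s u :=
  Finset.sum_nonneg fun e _ => G.cost_nonneg e _

theorem qFactor_pos : 0 < qFactor ι c := by unfold qFactor; positivity

theorem one_le_qFactor : 1 ≤ qFactor ι c := by
  have : (0 : ℝ) ≤ 1 / (Fintype.card ι : ℝ) ^ c := by positivity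
  unfold qFactor; linarith

theorem card_pos (h : GoodRun G f' ρ p c k x) : 1 ≤ Fintype.card ι :=
  Fintype.card_pos_iff.2 ⟨h.exists_pos.choose⟩

theorem two_le_blockRatio (h : GoodRun G f' ρ p c k x) : 2 ≤ G.blockRatio c := by
  have h1 : (1 : ℝ) ≤ Fintype.card ι := by exact_mod_cast h.card_pos
  have h2 : (1 : ℝ) ≤ (Fintype.card ι : ℝ) ^ (2 * c + 2) := one_le_pow₀ h1
  have h3 := h.one_le_Delta
  unfold blockRatio
  nlinarith

theorem ellMax_pos (h : GoodRun G f' ρ p c k x) : 0 < G.ellMax := by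
  obtain ⟨u, hu⟩ := h.exists_pos
  exact hu.trans_le (G.ell_le_ellMax u)

theorem bound_pos (h : GoodRun G f' ρ p c k x) (i : ℕ) : 0 < G.ellMax / G.blockRatio c ^ i := by
  have := h.ellMax_pos
  have := h.two_le_blockRatio
  positivity

theorem bound_anti (h : GoodRun G f' ρ p c k x) {i j : ℕ} (hij : i ≤ j) :
    G.ellMax / G.blockRatio c ^ j ≤ G.ellMax / G.blockRatio c ^ i := by
  have h1 := h.ellMax_pos
  have h2 := h.two_le_blockRatio
  gcongr
  linarith

theorem bound_succ (h : GoodRun G f' ρ p c k x) (i : ℕ) :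
    G.ellMax / G.blockRatio c ^ i = G.blockRatio c * (G.ellMax / G.blockRatio c ^ (i + 1)) := by
  have h2 := h.two_le_blockRatio
  have : G.blockRatio c ≠ 0 := by positivity
  field_simp
  ring

theorem inBlock_unique (h : GoodRun G f' ρ p c k x) {i j : ℕ} {u : ι} (hi : G.InBlock c i u)
    (hj : G.InBlock c j u) : i = j := by
  rcases lt_trichotomy i j with hij | hij | hij
  · exact absurd (hj.2.trans (h.bound_anti hij)) (not_le.2 hi.1)
  · exact hij
  · exact absurd (hi.2.trans (h.bound_anti hij)) (not_le.2 hj.1)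

theorem exists_inBlock (h : GoodRun G f' ρ p c k x) {u : ι} (hu : 0 < G.ell u) :
    ∃ i, G.InBlock c i u := by
  classical
  have h2 := h.two_le_blockRatio
  have hex : ∃ i, G.ellMax / G.blockRatio c ^ (i + 1) < G.ell u := by
    obtain ⟨n, hn⟩ := pow_unbounded_of_one_lt (G.ellMax / G.ell u)
      (by linarith : 1 < G.blockRatio c)
    refine ⟨n, ?_⟩
    rw [div_lt_iff₀ hu] at hn
    rw [div_lt_iff₀ (by positivity), pow_succ]
    have : 0 < G.blockRatio c ^ n * G.ell u := by positivity
    nlinarith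
  refine ⟨Nat.find hex, Nat.find_spec hex, ?_⟩
  rcases Nat.eq_zero_or_pos (Nat.find hex) with h0 | h0
  · rw [h0]; simpa using G.ell_le_ellMax u
  · have := Nat.find_min hex (Nat.sub_lt h0 one_pos)
    rw [not_lt, show Nat.find hex - 1 + 1 = Nat.find hex by omega] at this
    exact this

theorem exists_inBlock_zero (h : GoodRun G f' ρ p c k x) : ∃ u, G.InBlock c 0 u := by
  obtain ⟨u₀, _⟩ := h.exists_pos
  have : Nonempty ι := ⟨u₀⟩
  obtain ⟨u, hu⟩ := exists_eq_ciSup_of_finite (f := G.ell)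
  refine ⟨u, ?_, by simpa using G.ell_le_ellMax u⟩
  have h1 := h.ellMax_pos
  have h2 := h.two_le_blockRatio
  rw [hu]
  simp only [zero_add, pow_one]
  exact div_lt_self h1 (by linarith)

theorem step (h : GoodRun G f' ρ p c k x) {t : ℕ} (ht : t < k) :
    G.Step f' p c (x t) (x (t + 1)) := h.run.2 t ht

theorem phase_mono (h : GoodRun G f' ρ p c k x) {t t' : ℕ} (htt' : t ≤ t') (ht' : t' ≤ k) :
    (x t).1 ≤ (x t').1 := by
  induction t', htt' using Nat.le_induction with
  | base => exact le_rfl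
  | succ n hn ih =>
    refine (ih (by omega)).trans ?_
    rcases h.step (t := n) (by omega) with ⟨h1, _⟩ | ⟨_, _, h1, _⟩ <;> omega

theorem exists_inBlock_phase (h : GoodRun G f' ρ p c k x) {t : ℕ} (ht : t ≤ k) :
    ∃ u, G.InBlock c (x t).1 u := by
  induction t with
  | zero => rw [h.run.1.1]; exact h.exists_inBlock_zero
  | succ t ih =>
    rcases h.step (t := t) (by omega) with ⟨h1, _⟩ | ⟨_, _, _, h1, _⟩
    · rw [h1]; exact ih (by omega)
    · exact h1

theorem mem_strategies (h : GoodRun G f' ρ p c k x) {t : ℕ} (ht : t ≤ k) (u : ι) :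
    (x t).2 u ∈ G.strategies u := by
  induction t with
  | zero => exact (h.run.1.2 u).1
  | succ t ih =>
    rcases h.step (t := t) (by omega) with ⟨_, v, S, hm, hS⟩ | ⟨h1, _⟩
    · rw [hS]
      by_cases hv : u = v
      · subst hv
        rw [Function.update_self]
        rcases hm with ⟨_, _, hb⟩ | ⟨_, _, hb⟩ <;> exact hb.1
      · rw [Function.update_of_ne hv]; exact ih (by omega)
    · rw [h1]; exact ih (by omega)

/-- Every player always uses a strategy that is not much more expensive than its cheapest one. -/
theorem aloneCost_le (h : GoodRun G f' ρ p c k x) {t : ℕ} (ht : t ≤ k) (u : ι) :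
    G.aloneCost ((x t).2 u) ≤ ρ * G.Delta * G.ell u := by
  have hρ := h.one_lt
  have hD := h.one_le_Delta
  have hl := G.ell_nonneg u
  have hD0 : 0 ≤ G.Delta * G.ell u := by positivity
  induction t with
  | zero =>
    rw [(h.run.1.2 u).2]
    exact le_mul_of_one_le_left hl (by nlinarith)
  | succ t ih =>
    rcases h.step (t := t) (by omega) with ⟨_, v, S, hm, hS⟩ | ⟨h1, _⟩
    · rw [hS]
      by_cases hv : u = v
      · subst hv
        rw [Function.update_self]
        obtain ⟨t₀, ht₀, ht₀'⟩ := G.exists_aloneCost_eq_ell u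
        -- In any state the cheapest strategy costs at most `Δ ℓ_u`, so a best response costs at
        -- most this for the original costs and at most `ρ` times this for `f'`.
        have e0 : playerCost G.cost (Function.update (x t).2 u t₀) u ≤ G.Delta * G.ell u := by
          refine (playerCost_le_sum_card G.cost_mono _ _).trans ?_
          rw [Function.update_self, ← ht₀']
          exact h.sum_card_le t₀
        have e1 : G.aloneCost S ≤ playerCost G.cost (Function.update (x t).2 u S) u := by
          have := sum_one_le_playerCost G.cost_mono (Function.update (x t).2 u S) u
          rwa [Function.update_self] at this
        rcases hm with ⟨_, _, hb⟩ | ⟨_, _, hb⟩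
        · have := hb.2 t₀ ht₀
          nlinarith
        · have e2 := hb.2 t₀ ht₀
          have e3 := playerCost_le_mul h.modified_le (Function.update (x t).2 u t₀) u
          have e4 := h.playerCost_le_modified (Function.update (x t).2 u S) u
          have e5 := mul_le_mul_of_nonneg_left e0 (by linarith : 0 ≤ ρ)
          linarith
      · rw [Function.update_of_ne hv]; exact ih (by omega)
    · rw [h1]; exact ih (by omega)

theorem ell_le_playerCost (h : GoodRun G f' ρ p c k x) {t : ℕ} (ht : t ≤ k) (u : ι) :
    G.ell u ≤ playerCost G.cost (x t).2 u :=
  (G.ell_le (h.mem_strategies ht u)).trans (sum_one_le_playerCost G.cost_mono _ u)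

/-- Players of block `i` do not move in phases after phase `i`. -/
theorem eq_of_phase_lt (h : GoodRun G f' ρ p c k x) {t t' : ℕ} (htt' : t ≤ t') (ht' : t' ≤ k)
    {i : ℕ} {u : ι} (hu : G.InBlock c i u) (hi : i < (x t).1) : (x t').2 u = (x t).2 u := by
  induction t', htt' using Nat.le_induction with
  | base => rfl
  | succ n hn ih =>
    have ih := ih (by omega)
    have hn' := h.phase_mono hn (by omega)
    rcases h.step (t := n) (by omega) with ⟨_, v, S, hm, hS⟩ | ⟨h1, _⟩
    · rw [hS, Function.update_of_ne, ih]
      rintro rfl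
      rcases hm with ⟨hb, _⟩ | ⟨hb, _⟩ <;> have := h.inBlock_unique hu hb <;> omega
    · rw [h1, ih]

/-- The players that move from phase `i` on are in the blocks from `i` on. -/
theorem le_of_ne (h : GoodRun G f' ρ p c k x) {t t' : ℕ} (htt' : t ≤ t') (ht' : t' ≤ k)
    {u : ι} (hu : (x t').2 u ≠ (x t).2 u) : ∃ i, (x t).1 ≤ i ∧ G.InBlock c i u := by
  induction t', htt' using Nat.le_induction with
  | base => exact absurd rfl hu
  | succ n hn ih =>
    have hn' := h.phase_mono hn (by omega)
    by_cases hne : (x n).2 u = (x t).2 u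
    · rcases h.step (t := n) (by omega) with ⟨_, v, S, hm, hS⟩ | ⟨h1, _⟩
      · by_cases hv : u = v
        · subst hv
          rcases hm with ⟨hb, _⟩ | ⟨hb, _⟩
          · exact ⟨_, hn', hb⟩
          · exact ⟨_, by omega, hb⟩
        · rw [hS, Function.update_of_ne hv] at hu
          exact absurd hne hu
      · rw [h1] at hu
        exact absurd hne hu
    · exact ih (by omega) hne

/-- While the phase does not change, every step is an allowed move. -/
theorem exists_move (h : GoodRun G f' ρ p c k x) {t : ℕ} (ht : t < k)
    (hph : (x (t + 1)).1 = (x t).1) : ∃ u S, G.AllowedMove f' p c (x t).1 (x t).2 u S ∧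
      (x (t + 1)).2 = Function.update (x t).2 u S := by
  rcases h.step ht with ⟨_, h1⟩ | ⟨_, _, h1, _⟩
  · exact h1
  · omega

/-- `T` is the last time at which the phase number is at most `j`. If it were smaller than `j`
there, the next transition would skip a nonempty block. -/
theorem exists_isPhaseEnd (h : GoodRun G f' ρ p c k x) {j : ℕ} (hj : j ≤ (x k).1)
    (hne : ∃ u, G.InBlock c j u) : ∃ T, G.IsPhaseEnd f' p c k x j T := by
  classical
  set T := Nat.findGreatest (fun t => (x t).1 ≤ j) k with hT
  have hTk : T ≤ k := Nat.findGreatest_le k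
  have hTj : (x T).1 ≤ j := by
    have h0 : (x 0).1 ≤ j := by rw [h.run.1.1]; exact Nat.zero_le j
    exact Nat.findGreatest_spec (P := fun t => (x t).1 ≤ j) (Nat.zero_le k) h0
  have hgt : ∀ t, T < t → t ≤ k → j < (x t).1 := fun t ht ht' =>
    not_le.1 (Nat.findGreatest_is_greatest (P := fun t => (x t).1 ≤ j) ht ht')
  rcases hTk.lt_or_eq with hlt | heq
  · have h1 := hgt (T + 1) (by omega) (by omega)
    rcases h.step hlt with ⟨h2, _⟩ | ⟨h2, h3, h4, h5, h6⟩
    · omega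
    · have hTj' : (x T).1 = j := by
        by_contra hcon
        obtain ⟨u, hu⟩ := hne
        exact h6 j (by omega) h1 u hu
      rw [hTj'] at h3
      exact ⟨T, hTk, hTj', hgt, fun _ => ⟨h2, h3⟩⟩
  · refine ⟨T, hTk, ?_, hgt, fun h' => by omega⟩
    rw [heq] at hTj ⊢
    omega

/-- Without allowed moves, no player of the current block has a `p`-move. -/
theorem playerCost_le_of_not_allowed (h : GoodRun G f' ρ p c k x) {j : ℕ} {s : ι → Finset E}
    (hno : ∀ u S, ¬ G.AllowedMove f' p c j s u S) {u : ι} (hu : G.InBlock c j u) {t : Finset E}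
    (ht : t ∈ G.strategies u) :
    playerCost G.cost s u ≤ p * playerCost G.cost (Function.update s u t) u := by
  by_contra hcon
  rw [not_le] at hcon
  have hp : 0 < p := by linarith [h.one_lt, h.lt_p]
  obtain ⟨S, hS⟩ := G.exists_isBestResponse G.cost s u
  refine hno u S (Or.inl ⟨hu, ⟨t, ht, ?_⟩, hS⟩)
  rw [lt_div_iff₀ hp]
  linarith

/-- Without allowed moves, no player of the next block has a `q`-move. -/
theorem sub_le_of_not_allowed {j : ℕ} {s : ι → Finset E}
    (hno : ∀ u S, ¬ G.AllowedMove f' p c j s u S) {u : ι} (hu : G.InBlock c (j + 1) u)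
    {t : Finset E} (ht : t ∈ G.strategies u) :
    playerCost f' s u - playerCost f' (Function.update s u t) u ≤
      (1 - 1 / qFactor ι c) * playerCost f' s u := by
  by_contra hcon
  rw [not_le] at hcon
  obtain ⟨S, hS⟩ := G.exists_isBestResponse f' s u
  refine hno u S (Or.inr ⟨hu, ⟨t, ht, ?_⟩, hS⟩)
  rw [div_eq_mul_one_div, mul_comm]
  linarith

theorem mul_le_of_move {α : ℝ} {f : E → ℕ → ℝ} (hα : 0 < α) {s : ι → Finset E} {u : ι}
    {S : Finset E} (hm : G.HasMove f α s u) (hb : G.IsBestResponse f s u S) :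
    α * playerCost f (Function.update s u S) u ≤ playerCost f s u := by
  have := hb.lt_of_hasMove hm
  rw [lt_div_iff₀ hα] at this
  linarith

/-- The number of moves in a phase. -/
theorem moves_mul_le (h : GoodRun G f' ρ p c k x) {a b i : ℕ} (hab : a ≤ b) (hbk : b ≤ k)
    (hph : ∀ t, a ≤ t → t ≤ b → (x t).1 = i) {θ : ℝ} (hθ0 : 0 ≤ θ) (hθp : θ ≤ 1 - ρ / p)
    (hθq : θ ≤ 1 - 1 / qFactor ι c) :
    (b - a : ℕ) * θ ≤ Fintype.card ι * (ρ * G.Delta) ^ 2 * G.blockRatio c ^ 2 := by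
  classical
  have hρ := h.one_lt
  have hp := h.lt_p
  have hD := h.one_le_Delta
  have hp0 : 0 < p := by linarith
  set F : Finset ι := Finset.univ.filter fun w => G.InBlock c i w ∨ G.InBlock c (i + 1) w with hF
  set β : ℕ → ℝ := fun j => G.ellMax / G.blockRatio c ^ j with hβ
  have hβ0 : ∀ j, 0 < β j := h.bound_pos
  have hf'0 : ∀ e n, 0 < n → 0 ≤ f' e n := fun e n hn =>
    (G.cost_nonneg e n).trans (h.le_modified e n hn)
  -- Each move lowers the potential of `f'` by `θ` times the mover's cost at least, and that cost is
  -- at least the lower boundary of block `i + 1`. Only the two active blocks, collected in `F`,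
  -- move.
  have key : ∀ b, a ≤ b → b ≤ k → (∀ t, a ≤ t → t ≤ b → (x t).1 = i) →
      (b - a : ℕ) * (θ * β (i + 2)) ≤ potential f' (x a).2 - potential f' (x b).2 ∧
        ∀ w ∉ F, (x b).2 w = (x a).2 w := by
    intro b hab
    induction b, hab using Nat.le_induction with
    | base => intro _ _; simp
    | succ n hn ih =>
      intro hk hph
      obtain ⟨ih1, ih2⟩ := ih (by omega) fun t ht ht' => hph t ht (by omega)
      have hi := hph n hn (by omega)
      obtain ⟨u, S, hm, hS⟩ := h.exists_move (t := n) (by omega)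
        (by rw [hi, hph (n + 1) (by omega) le_rfl])
      rw [hi] at hm
      have e1 := potential_update_sub f' (x n).2 u S
      rw [← hS] at e1
      have hc := h.playerCost_le_modified (x n).2 u
      have hl := h.ell_le_playerCost (t := n) (by omega) u
      have hblock : β (i + 2) ≤ G.ell u ∧ u ∈ F := by
        rcases hm with ⟨hb, _⟩ | ⟨hb, _⟩
        · exact ⟨(h.bound_anti (by omega : i + 1 ≤ i + 2)).trans hb.1.le, by simp [hF, hb]⟩
        · exact ⟨hb.1.le, by simp [hF, hb]⟩
      have hdec : θ * playerCost f' (x n).2 u ≤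
          playerCost f' (x n).2 u - playerCost f' (x (n + 1)).2 u := by
        have hc0 : 0 ≤ playerCost f' (x n).2 u := by
          linarith [G.ell_nonneg u]
        rcases hm with ⟨_, hmv, hbr⟩ | ⟨_, hmv, hbr⟩
        · have e2 := mul_le_of_move hp0 hmv hbr
          rw [← hS] at e2
          have e3 := playerCost_le_mul h.modified_le (x (n + 1)).2 u
          have e4 : ρ * playerCost G.cost (x (n + 1)).2 u ≤
              ρ / p * playerCost G.cost (x n).2 u := by
            rw [div_mul_eq_mul_div, le_div_iff₀ hp0]
            nlinarith
          have e5 : ρ / p * playerCost G.cost (x n).2 u ≤ ρ / p * playerCost f' (x n).2 u := by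
            gcongr
          have e6 := mul_le_mul_of_nonneg_right hθp hc0
          linarith
        · have e2 := mul_le_of_move qFactor_pos hmv hbr
          rw [← hS] at e2
          have e3 : playerCost f' (x (n + 1)).2 u ≤ 1 / qFactor ι c * playerCost f' (x n).2 u := by
            rw [one_div, inv_mul_eq_div, le_div_iff₀ qFactor_pos]
            linarith
          have e6 := mul_le_mul_of_nonneg_right hθq hc0
          linarith
      refine ⟨?_, fun w hw => ?_⟩
      · have e7 : θ * β (i + 2) ≤ θ * playerCost f' (x n).2 u := by
          gcongr; linarith [hblock.1]
        rw [Nat.succ_sub hn]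
        push_cast
        linarith
      · rw [hS, Function.update_of_ne, ih2 w hw]
        rintro rfl
        exact hw hblock.2
  obtain ⟨h1, h2⟩ := key b hab hbk hph
  have h3 : potential f' (restrictTo Fᶜ (x a).2) ≤ potential f' (x b).2 := by
    rw [← restrictTo_congr fun w hw => h2 w (by simpa using hw)]
    exact potential_mono hf'0 (restrictTo_subset_self _ _)
  have h4 := potential_sub_le_mul h.modified_le (restrictTo_subset_self Fᶜ (x a).2)
  have h5 := potential_le_sdiff_add G.cost_mono (x a).2 Finset.univ F (Finset.subset_univ F)
  rw [restrictTo_univ, ← Finset.compl_eq_univ_sdiff] at h5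
  have h6 : ∑ w ∈ F, playerCost G.cost (x a).2 w ≤
      Fintype.card ι * (G.Delta * (ρ * G.Delta * β i)) := by
    have : ∀ w ∈ F, playerCost G.cost (x a).2 w ≤ G.Delta * (ρ * G.Delta * β i) := by
      intro w hw
      refine (playerCost_le_sum_card G.cost_mono _ _).trans ((h.sum_card_le _).trans ?_)
      have e1 := h.aloneCost_le (t := a) (by omega) w
      have e2 : G.ell w ≤ β i := by
        simp only [hF, Finset.mem_filter, Finset.mem_univ, true_and] at hw
        rcases hw with hw | hw
        · exact hw.2
        · exact hw.2.trans (h.bound_anti (by omega))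
      have : ρ * G.Delta * G.ell w ≤ ρ * G.Delta * β i := by gcongr
      gcongr
      linarith
    refine (Finset.sum_le_sum this).trans ?_
    rw [Finset.sum_const, nsmul_eq_mul]
    have : (F.card : ℝ) ≤ Fintype.card ι := by exact_mod_cast Finset.card_le_univ F
    have := hβ0 i
    gcongr
  have h7 : β i = G.blockRatio c ^ 2 * β (i + 2) := by
    have e1 : β i = G.blockRatio c * β (i + 1) := h.bound_succ i
    have e2 : β (i + 1) = G.blockRatio c * β (i + 2) := h.bound_succ (i + 1)
    rw [e1, e2]; ring
  refine le_of_mul_le_mul_right ?_ (hβ0 (i + 2))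
  have h8 : ρ * (potential G.cost (x a).2 - potential G.cost (restrictTo Fᶜ (x a).2)) ≤
      ρ * (Fintype.card ι * (G.Delta * (ρ * G.Delta * β i))) := by
    gcongr; linarith
  calc ((b - a : ℕ) : ℝ) * θ * β (i + 2) = (b - a : ℕ) * (θ * β (i + 2)) := by ring
    _ ≤ ρ * (Fintype.card ι * (G.Delta * (ρ * G.Delta * β i))) := by linarith
    _ = _ := by rw [h7]; ring

/-- The number of steps, given a bound `L` on the number of moves in a phase. -/
theorem steps_le (h : GoodRun G f' ρ p c k x) {L : ℕ}
    (hL : ∀ a b i : ℕ, a ≤ b → b ≤ k → (∀ t, a ≤ t → t ≤ b → (x t).1 = i) → b - a ≤ L) :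
    k ≤ Fintype.card ι * (L + 1) := by
  classical
  -- Every time is charged to a player of the block of its phase. Times charged to one player belong
  -- to a single phase, hence at most `L` moves and one further time.
  set A : ι → Finset ℕ := fun u => (Finset.range k).filter fun t => G.InBlock c (x t).1 u with hA
  have hcov : Finset.range k ⊆ Finset.univ.biUnion A := by
    intro t ht
    obtain ⟨u, hu⟩ := h.exists_inBlock_phase (t := t) (Finset.mem_range.1 ht).le
    exact Finset.mem_biUnion.2 ⟨u, Finset.mem_univ u, Finset.mem_filter.2 ⟨ht, hu⟩⟩
  have hcard : ∀ u ∈ (Finset.univ : Finset ι), (A u).card ≤ L + 1 := by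
    intro u _
    rcases (A u).eq_empty_or_nonempty with he | hne
    · rw [he]; simp
    · set a := (A u).min' hne with ha
      set b := (A u).max' hne with hb
      have hmem : ∀ t ∈ A u, t < k ∧ G.InBlock c (x t).1 u := fun t ht => by
        simpa [hA] using ht
      obtain ⟨hak, ha'⟩ := hmem a ((A u).min'_mem hne)
      obtain ⟨hbk, hb'⟩ := hmem b ((A u).max'_mem hne)
      have hab : a ≤ b := (A u).min'_le b ((A u).max'_mem hne)
      have heq := h.inBlock_unique ha' hb'
      have hba := hL a b (x a).1 hab hbk.le fun t hat htb => by
        have e1 := h.phase_mono hat (by omega)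
        have e2 := h.phase_mono htb hbk.le
        omega
      have hsub : A u ⊆ Finset.Icc a b := fun t ht =>
        Finset.mem_Icc.2 ⟨(A u).min'_le t ht, (A u).le_max' t ht⟩
      have := Finset.card_le_card hsub
      rw [Nat.card_Icc] at this
      omega
  calc k = (Finset.range k).card := (Finset.card_range k).symm
    _ ≤ (Finset.univ.biUnion A).card := Finset.card_le_card hcov
    _ ≤ (Finset.univ : Finset ι).card * (L + 1) := Finset.card_biUnion_le_card_mul _ _ _ hcard
    _ = _ := by rw [Finset.card_univ]

end GoodRun

end Run

end CongestionGame

/-! ### Influence of later phases and the final equilibrium -/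

namespace CongestionGame

variable {ι E : Type} [Fintype ι] [DecidableEq ι] [Fintype E] [DecidableEq E]

/-- Players in `M` influence the cost of a strategy only through the resources they use. -/
theorem sum_cost_le_add (G : CongestionGame ι E) {D : ℝ}
    (hD : ∀ e, G.cost e (Fintype.card ι) ≤ D * G.cost e 1) (hD0 : 0 ≤ D) (y z : ι → Finset E)
    (M : Finset ι) (hM : ∀ w ∉ M, y w = z w) (S : Finset E) :
    ∑ e ∈ S, G.cost e (load y e) ≤
      ∑ e ∈ S, G.cost e (load z e) + D * ∑ w ∈ M, G.aloneCost (y w) := by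
  have key : ∀ e ∈ S, G.cost e (load y e) ≤ G.cost e (load z e) +
      D * ∑ w ∈ M, if e ∈ y w then G.cost e 1 else 0 := by
    intro e _
    have hnn : ∀ w ∈ M, 0 ≤ if e ∈ y w then G.cost e 1 else 0 := fun w _ => by
      split_ifs <;> simp [G.cost_nonneg]
    by_cases hle : load y e ≤ load z e
    · have h1 := G.cost_mono e hle
      have h2 := mul_nonneg hD0 (Finset.sum_nonneg hnn)
      linarith
    -- If the load of `e` has grown, some player of `M` uses `e` only in `y`; `D` times its share
    -- `G.cost e 1` already covers the full cost of `e`.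
    · obtain ⟨w, hw, hw'⟩ : ∃ w, e ∈ y w ∧ e ∉ z w := by
        by_contra hcon
        push Not at hcon
        exact hle (Finset.card_le_card fun w => by simpa using hcon w)
      have hwM : w ∈ M := by
        by_contra hcon
        exact hw' (hM w hcon ▸ hw)
      have h1 : G.cost e 1 ≤ ∑ w ∈ M, if e ∈ y w then G.cost e 1 else 0 := by
        have := Finset.single_le_sum hnn hwM
        simpa [hw] using this
      have h2 := (G.cost_mono e (load_le_card y e)).trans (hD e)
      have h3 := mul_le_mul_of_nonneg_left h1 hD0
      linarith [G.cost_nonneg e (load z e)]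
  refine (Finset.sum_le_sum key).trans ?_
  rw [Finset.sum_add_distrib, ← Finset.mul_sum, Finset.sum_comm]
  have : ∀ w ∈ M, (∑ e ∈ S, if e ∈ y w then G.cost e 1 else 0) ≤ G.aloneCost (y w) := by
    intro w _
    rw [← Finset.sum_filter]
    exact Finset.sum_le_sum_of_subset_of_nonneg (fun e he => (Finset.mem_filter.1 he).2)
      fun e _ _ => G.cost_nonneg e 1
  have := mul_le_mul_of_nonneg_left (Finset.sum_le_sum this) hD0
  linarith

section Run

variable {G : CongestionGame ι E} {f' : E → ℕ → ℝ} {ρ p : ℝ} {c k : ℕ}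
  {x : ℕ → ℕ × (ι → Finset E)}

namespace GoodRun

/-- The players of block `i` that move in phase `i` have small costs, if block `i` starts the phase
without `q`-moves. -/
theorem sum_aloneCost_phase_le (h : GoodRun G f' ρ p c k x) {p' δ L : ℝ} {m : ℕ} (hρp' : ρ < p')
    (hp : p' < p) (hδ : 0 < δ) (hm : ρ / (1 - ρ / p) ≤ δ * m)
    (hδ' : 1 + 2 * δ ≤ (1 - (1 - 1 / qFactor ι c) * ρ * G.Delta) * (p' / ρ)) (hL : 1 ≤ L)
    (hLN : Fintype.card ι ≤ (1 - p' / p) * L) {a b i : ℕ} (hab : a ≤ b) (hbk : b ≤ k)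
    (hph : ∀ t, a ≤ t → t ≤ b → (x t).1 = i)
    (heq : ∀ w, G.InBlock c i w → ∀ t ∈ G.strategies w,
      playerCost f' (x a).2 w - playerCost f' (Function.update (x a).2 w t) w ≤
        (1 - 1 / qFactor ι c) * playerCost f' (x a).2 w)
    (W : Finset ι) (hW : ∀ w ∈ W, G.InBlock c i w ∧ (x b).2 w ≠ (x a).2 w) :
    ∑ w ∈ W, G.aloneCost ((x a).2 w) ≤ ((1 + δ + 2 * p') / δ + 2) *
        (Fintype.card ι * (ρ * G.Delta ^ 2 * (G.ellMax / G.blockRatio c ^ (i + 1)) * L ^ m)) ∧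
      ∑ w ∈ W, G.aloneCost ((x b).2 w) ≤ ((1 + δ + 2 * p') / δ + 2) *
        (Fintype.card ι * (ρ * G.Delta ^ 2 * (G.ellMax / G.blockRatio c ^ (i + 1)) * L ^ m)) := by
  classical
  have hρ := h.one_lt
  have hD := h.one_le_Delta
  have hp0 : 0 < p := by linarith
  set T := b - a with hT
  set y : ℕ → ι → Finset E := fun t => (x (a + t)).2 with hy
  have hya : y 0 = (x a).2 := rfl
  have hyb : y T = (x b).2 := by simp only [hy, hT, Nat.add_sub_cancel' hab]
  have hex : ∀ t, ∃ u, t < T → ∃ S, G.AllowedMove f' p c i (y t) u S ∧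
      y (t + 1) = Function.update (y t) u S := by
    intro t
    by_cases ht : t < T
    · obtain ⟨u, S, h1, h2⟩ := h.exists_move (t := a + t) (by omega)
        (by rw [hph _ (by omega) (by omega), hph _ (by omega) (by omega)])
      rw [hph _ (by omega) (by omega)] at h1
      exact ⟨u, fun _ => ⟨S, h1, h2⟩⟩
    · exact ⟨h.exists_pos.choose, fun h' => absurd h' ht⟩
  choose u hu using hex
  -- Blocks are disjoint, so `A t` decides which of the two kinds of move takes place.
  set A : ℕ → Prop := fun t => G.InBlock c i (u t) with hA
  have hpmove : ∀ t < T, A t → p * playerCost G.cost (y (t + 1)) (u t) ≤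
      playerCost G.cost (y t) (u t) := by
    intro t ht hAt
    obtain ⟨S, hm | hm, hS⟩ := hu t ht
    · rw [hS]; exact mul_le_of_move hp0 hm.2.1 hm.2.2
    · exact absurd (h.inBlock_unique hAt hm.1) (by omega)
  have hqmove : ∀ t < T, ¬ A t → G.InBlock c (i + 1) (u t) ∧
      playerCost f' (y (t + 1)) (u t) ≤ playerCost f' (y t) (u t) := by
    intro t ht hAt
    obtain ⟨S, hm | hm, hS⟩ := hu t ht
    · exact absurd hm.1 hAt
    · refine ⟨hm.1, ?_⟩
      have h1 := mul_le_of_move qFactor_pos hm.2.1 hm.2.2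
      rw [← hS] at h1
      have h2 : 0 ≤ playerCost f' (y (t + 1)) (u t) :=
        (playerCost_nonneg (G := G) _ _).trans (h.playerCost_le_modified _ _)
      nlinarith [one_le_qFactor (ι := ι) (c := c)]
  have hmain := movers_cost_le (f := G.cost) (f' := f') G.cost_mono G.cost_nonneg (ρ := ρ) (p := p)
    (p' := p') (τ := 1 - 1 / qFactor ι c) (D := G.Delta) (δ := δ)
    (h₀ := ρ * G.Delta ^ 2 * (G.ellMax / G.blockRatio c ^ (i + 1))) (L := L) (m := m) hρ.le hρp' hp
    h.smooth h.cost_card_le (by linarith)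
    (by
      rw [sub_nonneg, div_le_one qFactor_pos]; exact one_le_qFactor)
    hδ hm hδ' hL hLN
    (by have := (h.bound_pos (i + 1)).le; positivity)
    (x := y) (u := u) (A := A) (T := T)
    (fun t ht => by obtain ⟨S, _, hS⟩ := hu t ht; exact ⟨S, hS⟩)
    (Finset.univ.filter fun w => G.InBlock c i w)
    (Finset.univ.filter fun w => G.InBlock c (i + 1) w)
    (fun t _ hAt => by simpa using hAt) (fun t ht hAt => by simpa using (hqmove t ht hAt).1)
    hpmove (fun t ht hAt => (hqmove t ht hAt).2)
    (fun t ht w hw => by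
      have hw : G.InBlock c (i + 1) w := by simpa using hw
      refine (h.sum_card_le _).trans ?_
      have e1 := h.aloneCost_le (t := a + t) (by omega) w
      have e2 : ρ * G.Delta * G.ell w ≤
          ρ * G.Delta * (G.ellMax / G.blockRatio c ^ (i + 1)) := by
        have := hw.2
        gcongr
      have e3 := mul_le_mul_of_nonneg_left (e1.trans e2) (by linarith : 0 ≤ G.Delta)
      refine e3.trans (le_of_eq ?_)
      ring)
    (fun w hw => by
      have hw : G.InBlock c i w := by simpa using hw
      rw [hya, hyb]
      exact heq w hw _ (h.mem_strategies hbk w))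
  rw [hya, hyb] at hmain
  have hrun : DeviationRun y u T := fun t ht => by
    obtain ⟨S, _, hS⟩ := hu t ht; exact ⟨S, hS⟩
  have hsub : W ⊆ movers u T ∩ Finset.univ.filter fun w => G.InBlock c i w := by
    intro w hw
    obtain ⟨h1, h2⟩ := hW w hw
    refine Finset.mem_inter.2 ⟨?_, by simpa using h1⟩
    by_contra hcon
    exact h2 (by rw [← hyb, ← hya]; exact hrun.eq_of_notMem hcon)
  exact ⟨(Finset.sum_le_sum_of_subset_of_nonneg hsub fun _ _ _ => G.aloneCost_nonneg _).trans
      hmain.1,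
    (Finset.sum_le_sum_of_subset_of_nonneg hsub fun _ _ _ => G.aloneCost_nonneg _).trans hmain.2⟩

/-- The players that move after phase `j` have small costs. -/
theorem sum_aloneCost_later_le (h : GoodRun G f' ρ p c k x) {p' δ L : ℝ} {m : ℕ} (hρp' : ρ < p')
    (hp : p' < p) (hδ : 0 < δ) (hm : ρ / (1 - ρ / p) ≤ δ * m)
    (hδ' : 1 + 2 * δ ≤ (1 - (1 - 1 / qFactor ι c) * ρ * G.Delta) * (p' / ρ)) (hL : 1 ≤ L)
    (hLN : Fintype.card ι ≤ (1 - p' / p) * L) {j T : ℕ} (hT : G.IsPhaseEnd f' p c k x j T)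
    (W : Finset ι) (hW : ∀ w ∈ W, (x k).2 w ≠ (x T).2 w) :
    ∑ w ∈ W, G.aloneCost ((x T).2 w) ≤ ((1 + δ + 2 * p') / δ + 3) *
        (Fintype.card ι * (ρ * G.Delta ^ 2 * (G.ellMax / G.blockRatio c ^ (j + 2)) * L ^ m)) ∧
      ∑ w ∈ W, G.aloneCost ((x k).2 w) ≤ ((1 + δ + 2 * p') / δ + 3) *
        (Fintype.card ι * (ρ * G.Delta ^ 2 * (G.ellMax / G.blockRatio c ^ (j + 2)) * L ^ m)) := by
  classical
  have hρ := h.one_lt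
  have hD := h.one_le_Delta
  have hβ := h.bound_pos (j + 2)
  set β := G.ellMax / G.blockRatio c ^ (j + 2) with hβdef
  set Q := (Fintype.card ι : ℝ) * (ρ * G.Delta ^ 2 * β * L ^ m) with hQ
  have hp'0 : 0 < p' := by linarith
  have hC : 0 ≤ (1 + δ + 2 * p') / δ + 2 := by positivity
  have hQ0 : 0 ≤ Q := by positivity
  obtain ⟨hTk, hTj, hTlater, hTend⟩ := hT
  rcases hTk.lt_or_eq with hlt | rfl
  swap
  · have : W = ∅ := Finset.eq_empty_of_forall_notMem fun w hw => hW w hw rfl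
    subst this
    simp only [Finset.sum_empty]
    have : 0 ≤ ((1 + δ + 2 * p') / δ + 3) * Q := by nlinarith
    exact ⟨this, this⟩
  obtain ⟨hTx, hno⟩ := hTend hlt
  have hphT := hTlater (T + 1) (by omega) (by omega)
  have hblock : ∀ w ∈ W, ∃ i, (x (T + 1)).1 ≤ i ∧ G.InBlock c i w := fun w hw =>
    h.le_of_ne (t := T + 1) (t' := k) (by omega) le_rfl (by rw [hTx]; exact hW w hw)
  -- Block `j + 1` moves once more, in its own phase, which it enters without `q`-moves. Players of
  -- later blocks are cheap individually.
  set W₁ := W.filter fun w => G.InBlock c (j + 1) w with hW₁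
  set W₂ := W.filter fun w => ¬ G.InBlock c (j + 1) w with hW₂
  have hlater : ∀ t ≤ k, ∑ w ∈ W₂, G.aloneCost ((x t).2 w) ≤ Q := by
    intro t ht
    have : ∀ w ∈ W₂, G.aloneCost ((x t).2 w) ≤ ρ * G.Delta ^ 2 * β * L ^ m := by
      intro w hw
      obtain ⟨hwW, hw1⟩ := Finset.mem_filter.1 hw
      obtain ⟨i, hi, hib⟩ := hblock w hwW
      have hij : j + 2 ≤ i := by
        rcases (show j + 1 ≤ i by omega).lt_or_eq with h' | h'
        · exact h'
        · exact absurd (h' ▸ hib) hw1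
      have e1 := h.aloneCost_le ht w
      have e2 : G.ell w ≤ β := hib.2.trans (h.bound_anti hij)
      have e3 : (1 : ℝ) ≤ L ^ m := one_le_pow₀ hL
      calc G.aloneCost ((x t).2 w) ≤ ρ * G.Delta * G.ell w := e1
        _ ≤ ρ * G.Delta * β := by gcongr
        _ ≤ ρ * G.Delta * β * (G.Delta * L ^ m) := by
          refine le_mul_of_one_le_right (by positivity) ?_
          nlinarith
        _ = _ := by ring
    refine (Finset.sum_le_sum this).trans ?_
    rw [Finset.sum_const, nsmul_eq_mul]
    have : (W₂.card : ℝ) ≤ Fintype.card ι := by exact_mod_cast Finset.card_le_univ W₂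
    exact mul_le_mul_of_nonneg_right this (by positivity)
  have hnext : ∑ w ∈ W₁, G.aloneCost ((x T).2 w) ≤ ((1 + δ + 2 * p') / δ + 2) * Q ∧
      ∑ w ∈ W₁, G.aloneCost ((x k).2 w) ≤ ((1 + δ + 2 * p') / δ + 2) * Q := by
    -- If phase `j + 1` is skipped, later movers lie beyond block `j + 1`.
    rcases (show j + 1 ≤ (x (T + 1)).1 from hphT).lt_or_eq with hgt | heq
    · have : W₁ = ∅ := Finset.eq_empty_of_forall_notMem fun w hw => by
        obtain ⟨hwW, hw1⟩ := Finset.mem_filter.1 hw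
        obtain ⟨i, hi, hib⟩ := hblock w hwW
        have := h.inBlock_unique hw1 hib
        omega
      rw [this]
      simp only [Finset.sum_empty]
      exact ⟨by positivity, by positivity⟩
    · have hkph : j + 1 ≤ (x k).1 := by
        have := h.phase_mono (t := T + 1) (t' := k) (by omega) le_rfl
        omega
      obtain ⟨T', hT'k, hT'j, hT'later, hT'end⟩ := h.exists_isPhaseEnd hkph
        (by rw [heq]; exact h.exists_inBlock_phase (t := T + 1) (by omega))
      have hTT' : T + 1 ≤ T' := by
        by_contra hcon
        have := h.phase_mono (t := T') (t' := T) (by omega) hTk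
        omega
      have hsame : ∀ w, G.InBlock c (j + 1) w → (x k).2 w = (x T').2 w := by
        intro w hw
        rcases hT'k.lt_or_eq with h' | h'
        · rw [← (hT'end h').1]
          exact h.eq_of_phase_lt (by omega) le_rfl hw (hT'later (T' + 1) (by omega) (by omega))
        · rw [h']
      have := h.sum_aloneCost_phase_le hρp' hp hδ hm hδ' hL hLN (a := T + 1) (b := T') (i := j + 1)
        hTT' hT'k (fun t ht ht' => by
          have e1 := h.phase_mono (t := T + 1) (t' := t) ht (by omega)
          have e2 := h.phase_mono ht' hT'k
          omega)
        (fun w hw t ht => by rw [hTx]; exact sub_le_of_not_allowed hno hw ht) W₁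
        (fun w hw => by
          obtain ⟨hwW, hw1⟩ := Finset.mem_filter.1 hw
          refine ⟨hw1, ?_⟩
          rw [hTx, ← hsame w hw1]
          exact hW w hwW)
      rw [hTx] at this
      refine ⟨this.1, ?_⟩
      have e : ∑ w ∈ W₁, G.aloneCost ((x k).2 w) = ∑ w ∈ W₁, G.aloneCost ((x T').2 w) :=
        Finset.sum_congr rfl fun w hw => by rw [hsame w (Finset.mem_filter.1 hw).2]
      rw [e]
      exact this.2
  have hsplit : ∀ t, ∑ w ∈ W, G.aloneCost ((x t).2 w) =
      ∑ w ∈ W₁, G.aloneCost ((x t).2 w) + ∑ w ∈ W₂, G.aloneCost ((x t).2 w) := fun t =>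
    (Finset.sum_filter_add_sum_filter_not W _ _).symm
  have e1 := hlater T hTk
  have e2 := hlater k le_rfl
  rw [hsplit, hsplit]
  constructor <;> linarith [hnext.1, hnext.2]

theorem not_allowed_of_halted {y : ℕ × (ι → Finset E)} (hh : G.Halted f' p c y) (u : ι)
    (S : Finset E) : ¬ G.AllowedMove f' p c y.1 y.2 u S := fun hm =>
  hh (y.1, Function.update y.2 u S) (Or.inl ⟨rfl, u, S, hm, rfl⟩)

/-- Otherwise the transition to the next nonempty block would be possible. -/
theorem block_le_of_halted {y : ℕ × (ι → Finset E)} (hh : G.Halted f' p c y) {j : ℕ} {u : ι}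
    (hu : G.InBlock c j u) : j ≤ y.1 := by
  classical
  by_contra hcon
  have hex : ∃ i, y.1 < i ∧ ∃ u, G.InBlock c i u := ⟨j, by omega, u, hu⟩
  refine hh (Nat.find hex, y.2) (Or.inr ⟨rfl, not_allowed_of_halted hh, (Nat.find_spec hex).1,
    (Nat.find_spec hex).2, fun i hi hi' v hv => ?_⟩)
  exact Nat.find_min hex hi' ⟨hi, v, hv⟩

/-- When the algorithm stops, the state is an approximate equilibrium, provided the players that
move after phase `j` have small total cost. -/
theorem isApproxNash (h : GoodRun G f' ρ p c k x) (hh : G.Halted f' p c (x k)) {α : ℝ}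
    (hα : 0 ≤ α)
    (hlate : ∀ j u T, G.InBlock c j u → G.IsPhaseEnd f' p c k x j T → ∀ W : Finset ι,
      (∀ w ∈ W, (x k).2 w ≠ (x T).2 w) → ∃ B, (p + 1) * (G.Delta * B) ≤ (α - p) * G.ell u ∧
        ∑ w ∈ W, G.aloneCost ((x T).2 w) ≤ B ∧ ∑ w ∈ W, G.aloneCost ((x k).2 w) ≤ B) :
    G.IsApproxNash α (x k).2 := by
  classical
  have hρ := h.one_lt
  have hp := h.lt_p
  have hD := h.one_le_Delta
  intro u
  refine ⟨h.mem_strategies le_rfl u, fun t ht => ?_⟩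
  rcases (G.ell_nonneg u).lt_or_eq with hu | hu
  · obtain ⟨j, hj⟩ := h.exists_inBlock hu
    obtain ⟨T, hT⟩ := h.exists_isPhaseEnd (block_le_of_halted hh hj) ⟨u, hj⟩
    set W := Finset.univ.filter fun w => (x k).2 w ≠ (x T).2 w with hW
    obtain ⟨B, hB, hB1, hB2⟩ := hlate j u T hj hT W fun w hw => by simpa [hW] using hw
    have hWeq : ∀ w ∉ W, (x k).2 w = (x T).2 w := fun w hw => by simpa [hW] using hw
    obtain ⟨hTk, hTj, hTlater, hTend⟩ := hT
    have hno : ∀ v S, ¬ G.AllowedMove f' p c j (x T).2 v S := by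
      rcases hTk.lt_or_eq with h' | h'
      · exact (hTend h').2
      · subst h'; rw [← hTj]; exact not_allowed_of_halted hh
    have hu_eq : (x k).2 u = (x T).2 u := by
      rcases hTk.lt_or_eq with h' | h'
      · rw [← (hTend h').1]
        exact h.eq_of_phase_lt (by omega) le_rfl hj (hTlater (T + 1) (by omega) (by omega))
      · rw [h']
    have h1 := h.playerCost_le_of_not_allowed hno hj ht
    -- Since time `T`, later movers have raised the cost of `u` by at most `Δ B` and lowered that of
    -- the alternative `t` by at most `Δ B`. The total loss `(p + 1) Δ B` is at most `(α - p) ℓ_u`,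
    -- and `ℓ_u` bounds the cost of the alternative from below.
    have h2 := G.sum_cost_le_add h.cost_card_le (by linarith) (x k).2 (x T).2 W hWeq ((x k).2 u)
    have h3 := G.sum_cost_le_add h.cost_card_le (by linarith) (Function.update (x T).2 u t)
      (Function.update (x k).2 u t) W (fun w hw => by
        by_cases hwu : w = u
        · subst hwu; simp
        · rw [Function.update_of_ne hwu, Function.update_of_ne hwu, hWeq w hw]) t
    have e3 : ∑ w ∈ W, G.aloneCost (Function.update (x T).2 u t w) =
        ∑ w ∈ W, G.aloneCost ((x T).2 w) := Finset.sum_congr rfl fun w hw => by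
      rw [Function.update_of_ne]
      rintro rfl
      simp [hW, hu_eq] at hw
    rw [e3] at h3
    have e4 : ∀ s : ι → Finset E, ∑ e ∈ t, G.cost e (load (Function.update s u t) e) =
        playerCost G.cost (Function.update s u t) u := fun s => by
      unfold playerCost; rw [Function.update_self]
    rw [e4, e4] at h3
    have e5 : ∑ e ∈ (x k).2 u, G.cost e (load (x T).2 e) = playerCost G.cost (x T).2 u := by
      unfold playerCost; rw [hu_eq]
    have e6 : ∑ e ∈ (x k).2 u, G.cost e (load (x k).2 e) = playerCost G.cost (x k).2 u := rfl
    rw [e5, e6] at h2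
    have h4 : G.ell u ≤ playerCost G.cost (Function.update (x k).2 u t) u := by
      refine (G.ell_le ht).trans ?_
      have := sum_one_le_playerCost G.cost_mono (Function.update (x k).2 u t) u
      rwa [Function.update_self] at this
    have h5 := mul_le_mul_of_nonneg_left hB1 (by linarith : 0 ≤ G.Delta)
    have h6 := mul_le_mul_of_nonneg_left hB2 (by linarith : 0 ≤ G.Delta)
    have h7 : p * playerCost G.cost (Function.update (x T).2 u t) u ≤
        p * (playerCost G.cost (Function.update (x k).2 u t) u + G.Delta * B) := by
      have : 0 ≤ p := by linarith
      gcongr; linarith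
    have h8 : (α - p) * G.ell u ≤
        (α - p) * playerCost G.cost (Function.update (x k).2 u t) u := by
      have hB0 : 0 ≤ B := le_trans (Finset.sum_nonneg fun w _ => G.aloneCost_nonneg _) hB1
      have : 0 ≤ (α - p) * G.ell u :=
        le_trans (mul_nonneg (by linarith) (mul_nonneg (by linarith) hB0)) hB
      have : 0 ≤ α - p := nonneg_of_mul_nonneg_left this hu
      gcongr
    linarith
  -- A player with `ℓ_u = 0` only ever uses resources that cost nothing at any load up to the number
  -- of players.
  · have h1 := h.aloneCost_le le_rfl u
    have h2 := playerCost_le_sum_card G.cost_mono (x k).2 u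
    have h3 := h.sum_card_le ((x k).2 u)
    rw [← hu, mul_zero] at h1
    have h4 : 0 ≤ α * playerCost G.cost (Function.update (x k).2 u t) u :=
      mul_nonneg hα (playerCost_nonneg _ _)
    nlinarith

end GoodRun

end Run

end CongestionGame

/-! ### Polynomial growth and choice of the constants -/

/-- Besides strong smoothness, this growth bound is all that the analysis of the algorithm uses
about polynomials; it bounds `Δ`. -/
theorem eval_le_pow_mul_eval_one {P : Polynomial ℝ} {d : ℕ} (hP : P.natDegree ≤ d)
    (hP0 : ∀ j, 0 ≤ P.coeff j) {n : ℕ} (hn : 0 < n) :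
    P.eval (n : ℝ) ≤ (n : ℝ) ^ d * P.eval 1 := by
  rw [Polynomial.eval_eq_sum_range' (n := d + 1) (by omega),
    Polynomial.eval_eq_sum_range' (n := d + 1) (by omega), Finset.mul_sum]
  refine Finset.sum_le_sum fun j hj => ?_
  have h1 : (1 : ℝ) ≤ n := by exact_mod_cast hn
  have h2 : (n : ℝ) ^ j ≤ (n : ℝ) ^ d :=
    pow_le_pow_right₀ h1 (by simp at hj; omega)
  rw [one_pow, mul_one, mul_comm]
  exact mul_le_mul_of_nonneg_right h2 (hP0 j)

namespace CongestionGame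

section Delta

variable {ι E : Type} [Fintype ι] [DecidableEq ι] [Fintype E] [DecidableEq E]
  {G : CongestionGame ι E} {d : ℕ}

theorem cost_card_le_Delta_mul (hG : ∀ e n, 0 < n → G.cost e n ≤ (n : ℝ) ^ d * G.cost e 1)
    (hN : 0 < Fintype.card ι) (e : E) : G.cost e (Fintype.card ι) ≤ G.Delta * G.cost e 1 := by
  rcases (G.cost_nonneg e 1).lt_or_eq with h | h
  · rw [← div_le_iff₀ h]
    exact le_ciSup (f := fun e => G.cost e (Fintype.card ι) / G.cost e 1)
      (Set.finite_range _).bddAbove e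
  · have := hG e _ hN
    rw [← h, mul_zero] at this ⊢
    exact this

theorem Delta_le_pow (hG : ∀ e n, 0 < n → G.cost e n ≤ (n : ℝ) ^ d * G.cost e 1)
    (hN : 0 < Fintype.card ι) : G.Delta ≤ (Fintype.card ι : ℝ) ^ d := by
  refine Real.iSup_le (fun e => ?_) (by positivity)
  exact div_le_of_le_mul₀ (G.cost_nonneg e 1) (by positivity) (hG e _ hN)

theorem one_le_Delta {u : ι} (hu : 0 < G.ell u) : 1 ≤ G.Delta := by
  obtain ⟨t, _, ht⟩ := G.exists_aloneCost_eq_ell u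
  obtain ⟨e, _, he⟩ : ∃ e ∈ t, 0 < G.cost e 1 := by
    by_contra hcon
    push Not at hcon
    have : G.aloneCost t ≤ 0 := Finset.sum_nonpos hcon
    linarith
  have h1 : G.cost e (Fintype.card ι) / G.cost e 1 ≤ G.Delta :=
    le_ciSup (f := fun e => G.cost e (Fintype.card ι) / G.cost e 1) (Set.finite_range _).bddAbove e
  have h2 : 1 ≤ G.cost e (Fintype.card ι) / G.cost e 1 := by
    rw [one_le_div he]
    exact G.cost_mono e (Fintype.card_pos_iff.2 ⟨u⟩)
  exact h2.trans h1

/-- Without players of positive cost the algorithm stops in the initial state. -/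
theorem IsRun.eq_zero {f' : E → ℕ → ℝ} {p : ℝ} {c k : ℕ} {x : ℕ → ℕ × (ι → Finset E)}
    (h : G.IsRun f' p c k x) (hG : ∀ u, ¬ 0 < G.ell u) : k = 0 := by
  by_contra hk
  rcases h.2 0 (Nat.pos_of_ne_zero hk) with ⟨_, u, S, ⟨hb, _⟩ | ⟨hb, _⟩, _⟩ | ⟨_, _, _, ⟨u, hb⟩, _⟩
  · exact hG u hb.ell_pos
  · exact hG u hb.ell_pos
  · exact hG u hb.ell_pos

theorem isApproxNash_of_ell_eq_zero (hG : ∀ e n, 0 < n → G.cost e n ≤ (n : ℝ) ^ d * G.cost e 1)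
    {s : ι → Finset E} (hs : ∀ u, s u ∈ G.strategies u ∧ G.aloneCost (s u) = 0) {α : ℝ}
    (hα : 0 ≤ α) : G.IsApproxNash α s := by
  intro u
  refine ⟨(hs u).1, fun t _ => ?_⟩
  have h0 : ∀ e ∈ s u, G.cost e 1 = 0 :=
    (Finset.sum_eq_zero_iff_of_nonneg fun e _ => G.cost_nonneg e 1).1 (hs u).2
  have h1 : playerCost G.cost s u ≤ 0 := Finset.sum_nonpos fun e he => by
    have := hG e _ (load_pos he)
    rwa [h0 e he, mul_zero] at this
  exact h1.trans (mul_nonneg hα (GoodRun.playerCost_nonneg _ _))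

end Delta

/-- The middle term is exactly `1 / (N ^ c + 1)`. -/
theorem inv_two_mul_pow_le {ι : Type} [Fintype ι] (hN : 0 < Fintype.card ι) (c : ℕ) :
    1 / (2 * (Fintype.card ι : ℝ) ^ c) ≤ 1 - 1 / qFactor ι c ∧
      1 - 1 / qFactor ι c ≤ 1 / (Fintype.card ι : ℝ) ^ c := by
  have h1 : (1 : ℝ) ≤ Fintype.card ι := by exact_mod_cast hN
  have h2 : (1 : ℝ) ≤ (Fintype.card ι : ℝ) ^ c := one_le_pow₀ h1
  have e : 1 - 1 / qFactor ι c = 1 / ((Fintype.card ι : ℝ) ^ c + 1) := by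
    unfold qFactor
    have : (Fintype.card ι : ℝ) ^ c + 1 ≠ 0 := by positivity
    field_simp
    ring
  rw [e]
  constructor <;> apply one_div_le_one_div_of_le <;> linarith

/-- Polynomial bound on the number of steps. -/
theorem GoodRun.steps_le_eval {ι E : Type} [Fintype ι] [DecidableEq ι] [Fintype E] [DecidableEq E]
    {G : CongestionGame ι E} {f' : E → ℕ → ℝ} {ρ p : ℝ} {c k d : ℕ}
    {x : ℕ → ℕ × (ι → Finset E)} (h : GoodRun G f' ρ p c k x)
    (hΔ : G.Delta ≤ (Fintype.card ι : ℝ) ^ d) :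
    k ≤ Fintype.card ι *
      (⌈8 * ρ ^ 2 / (1 - ρ / p)⌉₊ * Fintype.card ι ^ (4 * d + 5 * c + 5) + 1) := by
  have hρ := h.one_lt
  have hp := h.lt_p
  have hD := h.one_le_Delta
  have hp0 : 0 < p := by linarith
  have hθ : 0 < 1 - ρ / p := by rw [sub_pos, div_lt_one hp0]; exact hp
  have hρp : 0 < ρ / p := by positivity
  set N : ℝ := (Fintype.card ι : ℝ) with hN
  have hN1 : 1 ≤ N := by rw [hN]; exact_mod_cast h.card_pos
  have hNc : 1 ≤ N ^ c := one_le_pow₀ hN1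
  refine h.steps_le fun a b i hab hbk hph => ?_
  have hq := (inv_two_mul_pow_le (ι := ι) h.card_pos c).1
  rw [← hN] at hq
  have hq0 : 0 < 1 / (2 * N ^ c) := by positivity
  have hq1 : 1 / (2 * N ^ c) ≤ 1 := by
    rw [div_le_one (by positivity)]; linarith
  have h1 := h.moves_mul_le hab hbk hph (θ := (1 - ρ / p) * (1 / (2 * N ^ c)))
    (by positivity) (mul_le_of_le_one_right hθ.le hq1)
    ((mul_le_of_le_one_left hq0.le (by linarith)).trans hq)
  have h2 : N * (ρ * G.Delta) ^ 2 * G.blockRatio c ^ 2 ≤ 4 * ρ ^ 2 * N ^ (4 * d + 4 * c + 5) := by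
    have e : N * (ρ * G.Delta) ^ 2 * G.blockRatio c ^ 2 =
        4 * ρ ^ 2 * (N * G.Delta ^ 4 * (N ^ (2 * c + 2)) ^ 2) := by
      unfold blockRatio; ring
    have e2 : N ^ (4 * d + 4 * c + 5) = N * (N ^ d) ^ 4 * (N ^ (2 * c + 2)) ^ 2 := by ring
    rw [e, e2]
    gcongr
  have h3 : ((b - a : ℕ) : ℝ) ≤ 8 * ρ ^ 2 / (1 - ρ / p) * N ^ (4 * d + 5 * c + 5) := by
    have e : 8 * ρ ^ 2 / (1 - ρ / p) * N ^ (4 * d + 5 * c + 5) =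
        4 * ρ ^ 2 * N ^ (4 * d + 4 * c + 5) / ((1 - ρ / p) * (1 / (2 * N ^ c))) := by
      field_simp
      ring
    rw [e, le_div_iff₀ (by positivity)]
    exact h1.trans h2
  have h4 : 8 * ρ ^ 2 / (1 - ρ / p) * N ^ (4 * d + 5 * c + 5) ≤
      ⌈8 * ρ ^ 2 / (1 - ρ / p)⌉₊ * N ^ (4 * d + 5 * c + 5) := by
    gcongr
    exact Nat.le_ceil _
  have h5 := h3.trans h4
  rw [hN] at h5
  exact_mod_cast h5

/-- Quality of the final state, for parameters `c` that are large compared to constants that depend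
on `ρ`, `p`, `η` and `d` only. -/
theorem GoodRun.isApproxNash_of_large {ι E : Type} [Fintype ι] [DecidableEq ι] [Fintype E]
    [DecidableEq E] {G : CongestionGame ι E} {f' : E → ℕ → ℝ} {ρ p : ℝ} {c k d : ℕ}
    {x : ℕ → ℕ × (ι → Finset E)} (h : GoodRun G f' ρ p c k x)
    (hΔ : G.Delta ≤ (Fintype.card ι : ℝ) ^ d) (hh : G.Halted f' p c (x k))
    {p' δ η : ℝ} {m : ℕ} (hρp' : ρ < p') (hp : p' < p) (hδ : 0 < δ) (hη : 0 < η)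
    (hδp' : p' / ρ = 1 + 3 * δ)
    (hm : ρ / (1 - ρ / p) ≤ δ * m) (hcm : m + 2 * d ≤ c)
    (hc : ρ * (1 + 3 * δ) * 2 ^ d ≤ δ * 2 ^ c)
    (hc' : (p + 1) * ((1 + δ + 2 * p') / δ + 3) * ρ * (1 / (1 - p' / p)) ^ m ≤ η * 2 ^ c) :
    G.IsApproxNash (p + η) (x k).2 := by
  have hρ := h.one_lt
  have hD := h.one_le_Delta
  have hp0 : 0 < p := by linarith
  have hp'0 : 0 < p' := by linarith
  have hκ : 0 < 1 - p' / p := by rw [sub_pos, div_lt_one hp0]; exact hp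
  refine h.isApproxNash hh (by linarith) fun j u T hj hT W hW => ?_
  -- A single player is treated apart, because powers of `N` absorb constants only for `N ≥ 2`;
  -- there, nobody else can move later.
  rcases (show 1 = Fintype.card ι ∨ 2 ≤ Fintype.card ι by have := h.card_pos; omega) with hN | hN
  · have hWe : W = ∅ := Finset.eq_empty_of_forall_notMem fun w hw => by
      have hwu : w = u := (Fintype.card_le_one_iff.1 hN.ge) w u
      subst hwu
      obtain ⟨hTk, _, hTlater, hTend⟩ := hT
      refine hW w hw ?_
      rcases hTk.lt_or_eq with h' | h'
      · rw [← (hTend h').1]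
        exact h.eq_of_phase_lt (by omega) le_rfl hj (hTlater (T + 1) (by omega) (by omega))
      · rw [h']
    subst hWe
    refine ⟨0, ?_, by simp, by simp⟩
    have := G.ell_nonneg u
    simp only [mul_zero, add_sub_cancel_left]
    positivity
  · set N : ℝ := (Fintype.card ι : ℝ) with hNdef
    have hN2 : 2 ≤ N := by rw [hNdef]; exact_mod_cast hN
    have hN1 : 1 ≤ N := by linarith
    have hq := (inv_two_mul_pow_le (ι := ι) h.card_pos c).2
    rw [← hNdef] at hq
    have hδ' : 1 + 2 * δ ≤ (1 - (1 - 1 / qFactor ι c) * ρ * G.Delta) * (p' / ρ) := by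
      rw [hδp']
      -- The equilibrium error is at most `ρ N ^ d / N ^ c`, which is largest at `N = 2` because `d
      -- ≤ c`.
      have e1 : (1 - 1 / qFactor ι c) * ρ * G.Delta ≤ ρ * 2 ^ d / 2 ^ c := by
        have e2 : (N ^ d) * 2 ^ c ≤ 2 ^ d * N ^ c := by
          obtain ⟨n, rfl⟩ := Nat.exists_eq_add_of_le (show d ≤ c by omega)
          rw [pow_add, pow_add]
          have : (2 : ℝ) ^ n ≤ N ^ n := by gcongr
          have h1 : (0 : ℝ) ≤ N ^ d * 2 ^ d := by positivity
          nlinarith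
        calc (1 - 1 / qFactor ι c) * ρ * G.Delta ≤ 1 / N ^ c * ρ * N ^ d := by gcongr
          _ = ρ * (N ^ d / N ^ c) := by ring
          _ ≤ ρ * (2 ^ d / 2 ^ c) := by
            gcongr ρ * ?_
            rw [div_le_div_iff₀ (by positivity) (by positivity)]
            exact e2
          _ = _ := by ring
      have e3 : ρ * 2 ^ d / 2 ^ c * (1 + 3 * δ) ≤ δ := by
        rw [div_mul_eq_mul_div, div_le_iff₀ (by positivity)]
        linarith
      have e4 := mul_le_mul_of_nonneg_right e1 (by positivity : 0 ≤ 1 + 3 * δ)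
      linarith
    set L := 1 / (1 - p' / p) * N with hLdef
    have hκ1 : 1 ≤ 1 / (1 - p' / p) := by
      rw [one_le_div hκ]
      have : 0 < p' / p := by positivity
      linarith
    have hL : 1 ≤ L := by rw [hLdef]; nlinarith
    have hLN : N ≤ (1 - p' / p) * L := by
      rw [hLdef, ← mul_assoc, mul_one_div_cancel hκ.ne', one_mul]
    obtain ⟨h1, h2⟩ := h.sum_aloneCost_later_le hρp' hp hδ hm hδ' hL hLN hT W hW
    refine ⟨_, ?_, h1, h2⟩
    have hβ := h.bound_pos (j + 2)
    have hβ' : G.ellMax / G.blockRatio c ^ (j + 1) =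
        G.blockRatio c * (G.ellMax / G.blockRatio c ^ (j + 2)) := h.bound_succ (j + 1)
    set β := G.ellMax / G.blockRatio c ^ (j + 2) with hβdef
    -- Between `ℓ_u` and the later movers lies a whole block, whose ratio `2 Δ N ^ (2 c + 2)` beats
    -- the losses `L ^ m` and `Δ ^ 2`.
    have hell : 2 * G.Delta * N ^ (2 * c + 2) * β ≤ G.ell u := by
      have := hj.1.le
      rwa [hβ'] at this
    set C := (1 + δ + 2 * p') / δ + 3 with hC
    have hC0 : 0 ≤ C := by positivity
    set κ := 1 / (1 - p' / p) with hκdef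
    have hκ0 : 0 ≤ κ := by linarith
    have hpow : (2 : ℝ) ^ c * N ^ (m + 1 + 2 * d) ≤ 2 * N ^ (2 * c + 2) := by
      have e1 : (2 : ℝ) ^ c ≤ N ^ c := by gcongr
      have e2 : N ^ (m + 1 + 2 * d) ≤ N ^ (c + 2) := pow_le_pow_right₀ hN1 (by omega)
      calc (2 : ℝ) ^ c * N ^ (m + 1 + 2 * d) ≤ N ^ c * N ^ (c + 2) := by gcongr
        _ = N ^ (2 * c + 2) := by ring
        _ ≤ 2 * N ^ (2 * c + 2) := by linarith [pow_pos (by linarith : 0 < N) (2 * c + 2)]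
    calc (p + 1) * (G.Delta * (C * (N * (ρ * G.Delta ^ 2 * β * L ^ m))))
        = (p + 1) * C * ρ * κ ^ m * (N ^ (m + 1) * G.Delta ^ 2) * (G.Delta * β) := by
          rw [hLdef, mul_pow]; ring
      _ ≤ η * 2 ^ c * (N ^ (m + 1) * (N ^ d) ^ 2) * (G.Delta * β) := by gcongr
      _ = η * (2 ^ c * N ^ (m + 1 + 2 * d)) * (G.Delta * β) := by ring
      _ ≤ η * (2 * N ^ (2 * c + 2)) * (G.Delta * β) := by gcongr
      _ = η * (2 * G.Delta * N ^ (2 * c + 2) * β) := by ring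
      _ ≤ η * G.ell u := by gcongr
      _ = (p + η - p) * G.ell u := by ring

/-- The algorithm for costs of polynomial growth with a strongly smooth modification. -/
theorem exists_algorithm_bounds (d : ℕ) {ρ p ε : ℝ} (hρ : 1 < ρ) (hp : ρ < p) (hpε : p < ρ + ε) :
    ∃ c₀ : ℕ, ∀ c ≥ c₀, ∃ Q : Polynomial ℕ, ∀ (ι E : Type) [Fintype ι] [DecidableEq ι] [Fintype E]
      [DecidableEq E] (G : CongestionGame ι E) (f' : E → ℕ → ℝ),
      (∀ e, StronglySmooth ρ (G.cost e) (f' e)) →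
      (∀ e n, 0 < n → G.cost e n ≤ (n : ℝ) ^ d * G.cost e 1) →
      ∀ (k : ℕ) (x : ℕ → ℕ × (ι → Finset E)), G.IsRun f' p c k x →
        k ≤ Q.eval (Fintype.card ι) ∧
          (G.Halted f' p c (x k) → G.IsApproxNash (ρ + ε) (x k).2) := by
  -- The choice makes `p' / ρ = 1 + 3 δ`: one `δ` pays for the equilibrium error, one for the
  -- window, and one remains as the margin. The slack `η` between `p` and `ρ + ε` pays for the
  -- influence of later phases.
  set p' := (ρ + p) / 2 with hp'
  set δ := (p' / ρ - 1) / 3 with hδdef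
  set η := ρ + ε - p with hη
  have hρ0 : 0 < ρ := by linarith
  have hδ : 0 < δ := by
    have : 1 < p' / ρ := by rw [one_lt_div hρ0]; linarith
    rw [hδdef]; linarith
  have hη0 : 0 < η := by linarith
  obtain ⟨m, hm⟩ := exists_nat_ge (ρ / (1 - ρ / p) / δ)
  rw [div_le_iff₀ hδ, mul_comm] at hm
  obtain ⟨n₁, hn₁⟩ := pow_unbounded_of_one_lt (ρ * (1 + 3 * δ) * 2 ^ d / δ)
    (by norm_num : (1 : ℝ) < 2)
  obtain ⟨n₂, hn₂⟩ := pow_unbounded_of_one_lt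
    ((p + 1) * ((1 + δ + 2 * p') / δ + 3) * ρ * (1 / (1 - p' / p)) ^ m / η)
    (by norm_num : (1 : ℝ) < 2)
  refine ⟨n₁ + n₂ + (m + 2 * d), fun c hc => ⟨Polynomial.X *
    (Polynomial.C ⌈8 * ρ ^ 2 / (1 - ρ / p)⌉₊ * Polynomial.X ^ (4 * d + 5 * c + 5) + 1), ?_⟩⟩
  intro ι E _ _ _ _ G f' hsm hG k x hrun
  simp only [Polynomial.eval_mul, Polynomial.eval_X, Polynomial.eval_add, Polynomial.eval_C,
    Polynomial.eval_pow, Polynomial.eval_one]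
  by_cases hpos : ∃ u, 0 < G.ell u
  · have hN : 0 < Fintype.card ι := Fintype.card_pos_iff.2 ⟨hpos.choose⟩
    have hgood : GoodRun G f' ρ p c k x := ⟨hrun, hsm, hρ, hp, one_le_Delta hpos.choose_spec,
      cost_card_le_Delta_mul hG hN, hpos⟩
    have hΔ := Delta_le_pow hG hN
    refine ⟨hgood.steps_le_eval hΔ, fun hh => ?_⟩
    have e : ρ + ε = p + η := by rw [hη]; ring
    rw [e]
    refine hgood.isApproxNash_of_large hΔ hh (p' := p') (δ := δ) (m := m) (by linarith)
      (by linarith) hδ hη0 (by rw [hδdef]; ring) hm (by omega) ?_ ?_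
    · rw [div_lt_iff₀ hδ] at hn₁
      have : (2 : ℝ) ^ n₁ ≤ 2 ^ c := pow_le_pow_right₀ (by norm_num) (by omega)
      nlinarith
    · rw [div_lt_iff₀ hη0] at hn₂
      have : (2 : ℝ) ^ n₂ ≤ 2 ^ c := pow_le_pow_right₀ (by norm_num) (by omega)
      nlinarith
  · have hk := hrun.eq_zero fun u hu => hpos ⟨u, hu⟩
    subst hk
    refine ⟨Nat.zero_le _, fun _ => isApproxNash_of_ell_eq_zero hG (fun u => ?_) (by linarith)⟩
    have h1 := hrun.1.2 u
    refine ⟨h1.1, h1.2.trans (le_antisymm (not_lt.1 fun hu => hpos ⟨u, hu⟩) (G.ell_nonneg u))⟩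

end CongestionGame

/-! ### The theorem -/

theorem theorem1 :
    -- the finite programs attain their optimal values, which are as listed
    (∀ d ∈ Finset.Icc 1 5, IsLeast (LPValues d) (rho d)) ∧
    (|rho 1 - 1.61| ≤ 0.005 ∧ |rho 2 - 3.35| ≤ 0.005 ∧ |rho 3 - 8.58| ≤ 0.005 ∧
      |rho 4 - 27.46| ≤ 0.005 ∧ |rho 5 - 98.14| ≤ 0.005) ∧
    -- every optimal solution of a finite program extends to a function that is smooth for all loads
    (∀ d ∈ Finset.Icc 1 5, ∀ g : ℕ → ℝ, LPFeasible 150 d (rho d) g →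
      ∀ z n m : ℕ, SmoothAt d (rho d) (extendCost d g) z n m) ∧
    -- the algorithm, run with these modified costs
    (∀ d ∈ Finset.Icc 1 5, ∀ ε : ℝ, 0 < ε → ∀ p : ℝ, rho d < p → p < rho d + ε →
      ∃ c₀ : ℕ, ∀ c ≥ c₀, ∃ Q : Polynomial ℕ,
        ∀ g : ℕ → ℕ → ℝ, (∀ j ∈ Finset.Icc 1 d, LPFeasible 150 j (rho j) (g j)) →
        ∀ (ι E : Type) [Fintype ι] [DecidableEq ι] [Fintype E] [DecidableEq E]
          (G : CongestionGame ι E) (P : E → Polynomial ℝ),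
          (∀ e, (P e).natDegree ≤ d ∧ (∀ j, 0 ≤ (P e).coeff j) ∧
            ∀ n : ℕ, G.cost e n = (P e).eval (n : ℝ)) →
          ∀ (k : ℕ) (x : ℕ → ℕ × (ι → Finset E)),
            G.IsRun (fun e => modifiedCost d g (P e)) p c k x →
              k ≤ Q.eval (Fintype.card ι) ∧
              (G.Halted (fun e => modifiedCost d g (P e)) p c (x k) →
                G.IsApproxNash (rho d + ε) (x k).2)) := by
  refine ⟨fun d hd => isLeast_rho_of_mem hd, ?_, fun d hd g hg z n m =>
    smoothAt_extendCost hd hg z n m, ?_⟩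
  · have h1 := rho_bounds_one
    have h2 := rho_bounds_two
    have h3 := rho_bounds_three
    have h4 := rho_bounds_four
    have h5 := rho_bounds_five
    simp only [abs_le]
    refine ⟨⟨?_, ?_⟩, ⟨?_, ?_⟩, ⟨?_, ?_⟩, ⟨?_, ?_⟩, ⟨?_, ?_⟩⟩ <;> linarith
  · intro d hd ε _ p hp hpε
    obtain ⟨c₀, h⟩ := CongestionGame.exists_algorithm_bounds d (one_lt_rho hd) hp hpε
    refine ⟨c₀, fun c hc => ?_⟩
    obtain ⟨Q, hQ⟩ := h c hc
    refine ⟨Q, fun g hg ι E _ _ _ _ G P hP k x hrun => ?_⟩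
    have hcost : ∀ e, G.cost e = fun n : ℕ => (P e).eval (n : ℝ) := fun e => funext (hP e).2.2
    refine hQ ι E G _ (fun e => ?_) (fun e n hn => ?_) k x hrun
    · rw [hcost e]
      exact stronglySmooth_modifiedCost hd hg (hP e).1 (hP e).2.1
    · rw [(hP e).2.2, (hP e).2.2, Nat.cast_one]
      exact eval_le_pow_mul_eval_one (hP e).1 (hP e).2.1 hn
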